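/- Consider group presentations $\langle \mathcal{A} \,\|\, \mathcal{R}\rangle$, where $\mathcal{A}$ is a finite alphabet and $\mathcal{R}$ is a (finite or infinite) set of nonempty cyclically reduced words over $\mathcal{A}^{\pm1}$; let $\langle\langle \mathcal{R}\rangle\rangle$ be the normal closure of $\mathcal{R}$ in the free group $F(\mathcal{A})$. A van Kampen diagram over the presentation is a finite, connected, simply connected planar 2-complex $\Delta$ whose oriented edges are labelled by letters of $\mathcal{A}^{\pm1}$ (inverse edges having inverse labels) so that the boundary of every 2-cell is labelled, up to cyclic shift and direction, by a word of $\mathcal{R}$. For $j\in\{0,1,2\}$ and a word $W$ over $\mathcal{A}^{\pm1}$ representing an element of $\langle\langle \mathcal{R}\rangle\rangle$, let $L_j(W)$ be the minimal number of $j$-cells in a van Kampen diagram whose boundary is labelled by the cyclic word $W$. The Dehn $j$-function of the presentation is $$f_j(x)=\max\{L_j(W) \mid W\in\langle\langle \mathcal{R}\rangle\rangle,\ |W|\le x\}\qquad (x=1,2,\dots).$$ For functions $f,g:\{1,2,\dots\}\to\{0,1,2,\dots\}$ write $f\preccurlyeq g$ if there is an integer $C>0$ such that $f(x)\le C\,g(Cx)+Cx$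 for all $x\ge 1$, and $f\simeq g$ if $f\preccurlyeq g$ and $g\preccurlyeq f$. Theorem 1.6. (a) Let $\langle \mathcal{A}\,\|\,\mathcal{R}'\rangle$ be obtained from $\langle \mathcal{A}\,\|\,\mathcal{R}\rangle$ by a $T$-transformation, i.e. $\mathcal{R}'=(\mathcal{R}\setminus\mathcal{S})\cup\mathcal{U}$, where $\mathcal{S}$ is a finite subset of $\mathcal{R}$, $\mathcal{U}$ is a finite set of nonempty cyclically reduced words, and $\langle\langle \mathcal{R}'\rangle\rangle=\langle\langle \mathcal{R}\rangle\rangle$. Let $f_j$ and $f'_j$ be the Dehn $j$-functions of $\langle \mathcal{A}\,\|\,\mathcal{R}\rangle$ and $\langle \mathcal{A}\,\|\,\mathcal{R}'\rangle$. Then $f'_0\preccurlyeq f_1$, $f'_1\simeq f_1$ and $f'_2\simeq f_2$. (b) Let $\langle \mathcal{A}'\,\|\,\mathcal{R}'\rangle$ be obtained from $\langle \mathcal{A}\,\|\,\mathcal{R}\rangle$ by a stabilization, i.e. either $\mathcal{A}'=\mathcal{A}\cup\{b\}$ and $\mathcal{R}'=\mathcal{R}\cup\{b\}$ for a letter $b\notin\mathcal{A}$,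 or, conversely, $\mathcal{A}=\mathcal{A}'\cup\{b\}$ and $\mathcal{R}=\mathcal{R}'\cup\{b\}$ for a letter $b\notin\mathcal{A}'$. Let $f_j$ and $f'_j$ be the corresponding Dehn $j$-functions. Then $f'_j\simeq f_j$ for $j=0,1,2$. -/

import Mathlib

namespace DehnPres

/-- Words over the alphabet `A ∪ A⁻¹`: the pair `(a, true)` is the letter `a`, and `(a, false)` is
`a⁻¹`. Words are compared literally; they need not be reduced. -/
abbrev Word (A : Type*) : Type _ := List (A × Bool)

/-- A group presentation `⟨A ‖ R⟩`: a set, finite or infinite, of nonempty cyclically reduced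
words over `A ∪ A⁻¹`. -/
structure Presentation (A : Type*) where
  /-- the set of defining relators -/
  rels : Set (Word A)
  rels_ne_nil : ∀ r ∈ rels, r ≠ []
  rels_cyclicallyReduced : ∀ r ∈ rels, FreeGroup.IsCyclicallyReduced r

/-- The normal closure of the relators in the free group on `A`. -/
def Presentation.closure {A : Type*} (P : Presentation A) : Subgroup (FreeGroup A) :=
  Subgroup.normalClosure (FreeGroup.mk '' P.rels)

/-- Each edge `e` has the two orientations `(e, true)` and `(e, false)`; this permutation of the
oriented edges reverses the orientation. -/
def reversal (E : Type*) : Equiv.Perm (E × Bool) :=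
  Equiv.prodCongr (Equiv.refl E) Equiv.boolNot

/-- A finite, connected, simply connected planar 2-complex whose edges are labelled by the letters
of `A ∪ A⁻¹`, given combinatorially: the plane (one-point compactified) is cut into regions, one
for each 2-cell and one outer region (`none`), and the cellular structure of this sphere is
recorded by a permutation of the oriented edges. -/
structure Diagram (A : Type*) where
  /-- the 0-cells -/
  Vertex : Type
  /-- the 1-cells (unoriented) -/
  Edge : Type
  /-- the 2-cells -/
  Face : Type
  finite_vertex : Finite Vertex
  finite_edge : Finite Edge
  finite_face : Finite Face
  /-- The letter of `A` carried by the edge `e`, where `(e, true)` is the orientation in which the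
  letter has exponent `+1`. -/
  label : Edge → A
  /-- the initial vertex of an oriented edge -/
  origin : Edge × Bool → Vertex
  /-- the region on the left of an oriented edge: a 2-cell, or the outer region `none` -/
  region : Edge × Bool → Option Face
  /-- the oriented edge that follows `d` on the boundary walk of the region on the left of `d` -/
  next : Equiv.Perm (Edge × Bool)
  /-- The oriented edges leaving a vertex are arranged in one cyclic order around it. (In
  particular, `next d` starts at the vertex where `d` ends.) -/
  vertex_cycle : ∀ v, (next * reversal Edge).IsCycleOn {d | origin d = v}
  /-- The boundary of each region is one closed walk. -/
  region_cycle : ∀ r, next.IsCycleOn {d | region d = r}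
  /-- Unless there are no edges at all, every region has an edge on its boundary. -/
  region_nonempty : Nonempty Edge → ∀ r, ∃ d, region d = r
  nonempty : Nonempty Vertex
  connected : ∀ u v, Relation.ReflTransGen
    (fun x y => ∃ d, origin d = x ∧ origin (reversal Edge d) = y) u v
  /-- Euler's formula `V - E + F = 1`, the outer region not being counted: the surface formed by all
  regions is the sphere. -/
  euler : Nat.card Vertex + Nat.card Face = Nat.card Edge + 1

namespace Diagram

variable {A : Type*} (Δ : Diagram A)

/-- The number of `j`-cells. -/
noncomputable def cells (j : Fin 3) : ℕ :=
  ![Nat.card Δ.Vertex, Nat.card Δ.Edge, Nat.card Δ.Face] j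

/-- The label of a path, as a word. -/
def word (p : List (Δ.Edge × Bool)) : Word A :=
  p.map fun d => (Δ.label d.1, d.2)

/-- The closed path `p` is the boundary walk of the region `r`, read from some starting point. -/
def IsBoundaryWalk (r : Option Δ.Face) (p : List (Δ.Edge × Bool)) : Prop :=
  p.Nodup ∧ (∀ d, d ∈ p ↔ Δ.region d = r) ∧ p.map Δ.next = p.rotate 1

/-- `Δ` is a van Kampen diagram over `P`: the boundary of every 2-cell is labelled, from some
starting point and in one of the two directions, by a relator. -/
def IsOver (P : Presentation A) : Prop :=
  ∀ f : Δ.Face, ∃ p, Δ.IsBoundaryWalk (some f) p ∧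
    (Δ.word p ∈ P.rels ∨ FreeGroup.invRev (Δ.word p) ∈ P.rels)

/-- The boundary of `Δ`, read from some starting point, is labelled by `W`, that is, `∂Δ` is
labelled by the cyclic word `W`. The direction is fixed here; the other one is obtained by passing
to the mirror image of the diagram. -/
def HasBoundaryLabel (W : Word A) : Prop :=
  ∃ p, Δ.IsBoundaryWalk none p ∧ Δ.word p = W

end Diagram

/-- `L_j(W)`: the minimal number of `j`-cells in a van Kampen diagram over `P` whose boundary is
labelled by the cyclic word `W`. -/
noncomputable def minCells {A : Type*} (P : Presentation A) (j : Fin 3) (W : Word A) : ℕ :=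
  sInf {n | ∃ Δ : Diagram A, Δ.IsOver P ∧ Δ.HasBoundaryLabel W ∧ Δ.cells j = n}

/-- The Dehn `j`-function: the maximum of `L_j(W)` over all words `W` of length at most `x` that
represent elements of the normal closure of the relators. -/
noncomputable def dehn {A : Type*} (P : Presentation A) (j : Fin 3) (x : ℕ) : ℕ :=
  sSup {n | ∃ W : Word A, FreeGroup.mk W ∈ P.closure ∧ W.length ≤ x ∧ minCells P j W = n}

/-- `f ≼ g` for functions on the positive integers. -/
def Dominated (f g : ℕ → ℕ) : Prop :=
  ∃ C : ℕ, 0 < C ∧ ∀ x : ℕ, 1 ≤ x → f x ≤ C * g (C * x) + C * x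

/-- `f ≃ g`: linear equivalence. -/
def LinEquiv (f g : ℕ → ℕ) : Prop :=
  Dominated f g ∧ Dominated g f

/-- `P'` is obtained from `P` by a `T`-transformation: a finite set `S` of relators is replaced by a
finite set `U` of words (nonempty and cyclically reduced, `P'` being a presentation), and the normal
closure of the relators does not change. -/
def IsTTransformation {A : Type*} (P P' : Presentation A) : Prop :=
  ∃ S U : Set (Word A), S ⊆ P.rels ∧ S.Finite ∧ U.Finite ∧ P'.rels = (P.rels \ S) ∪ U ∧
    P'.closure = P.closure

/-- `P'` is obtained from `P` by adding a new letter `b` to the alphabet and to the relators. The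
alphabet `A` is regarded as a subset of `A'` by means of `i`. -/
def AddsLetter {A A' : Type*} (P : Presentation A) (P' : Presentation A') : Prop :=
  ∃ (i : A ↪ A') (b : A'), Set.range i = {b}ᶜ ∧
    P'.rels = insert [(b, true)] ((List.map (Prod.map i id)) '' P.rels)

/-- A stabilization adds or deletes a letter. -/
def IsStabilization {A A' : Type*} (P : Presentation A) (P' : Presentation A') : Prop :=
  AddsLetter P P' ∨ AddsLetter P' P

end DehnPres

namespace DehnPres

open FreeGroup (mk invRev)

variable {A : Type*}

/-! ### Products of conjugates of relators, and disc diagrams as an inductive type -/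

section Algebra

/-! Cells of diagrams are counted algebraically. A diagram with boundary `W`, `e` edges and `f`
faces writes `W` as a product of `f` conjugates of relators of total length `m`, and counting every
edge from both sides gives `2 * e = W.length + m` (`Disc.area`). Conversely, van Kampen's lemma
turns a product of `n` conjugates of total length `m` into a diagram with at most `n` faces and `2 *
e ≤ W.length + m` (`Area.exists_disc`).

For a T-transformation, the finitely many lost relators are products of conjugates of the new ones,
so a single `K` controls the substitution (`exists_relator_bound`). It multiplies the number of
faces by at most `K` and turns `e` edges into at most `K * e + W.length`. Vertices are bounded by
edges through Euler's formula, but this argument has no bound in the other direction; this is why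
`f'_0` is compared with `f_1`. Exchanging the two presentations gives the equivalences.

For a stabilization by `b`, contracting the edges labelled `b` and dropping the faces bounded by
them never increases a count (`Disc.deleteLetter`). Conversely, each letter `b` of a boundary is
supplied by a loop bounding a face, at the cost of one edge, one face and no vertex
(`Disc.insert_loop`).

It remains to see that `Disc` describes exactly the diagrams. To decompose a diagram, the first
boundary edge is deleted. If a face lies behind it, the face is opened to the outside. Otherwise the
outer region is on both sides and the edge must separate, because the surface is a sphere. This is
proved by linear algebra: coboundaries of vertex functions and boundaries of region functions are
orthogonal in `ℚ^E`, which bounds `V + R` by `E + 2`, and in the case of equality they span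
(`card_add_card_le`, `IsSurfaceMap.disc`). Conversely, a diagram is grown by adding spikes and faces
(`Disc.realizable_append`). -/

theorem mk_append (u v : Word A) : mk (u ++ v) = mk u * mk v := FreeGroup.mul_mk.symm

theorem mk_cons (x : A × Bool) (v : Word A) : mk (x :: v) = mk [x] * mk v :=
  mk_append [x] v

theorem mk_invRev (w : Word A) : mk (invRev w) = (mk w)⁻¹ := FreeGroup.inv_mk.symm

theorem mk_inv_letter (x : A × Bool) : mk [(x.1, !x.2)] = (mk [x])⁻¹ := mk_invRev [x]

/-- Up to a cyclic shift, `w` is a relator or the inverse of a relator. -/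
def Presentation.IsFaceLabel (P : Presentation A) (w : Word A) : Prop :=
  ∃ r, r.IsRotated w ∧ (r ∈ P.rels ∨ invRev r ∈ P.rels)

/-- `Area P g n m`: the element `g` of the free group is a product of `n` conjugates of relators
and inverses of relators, of total length `m`. -/
inductive Area (P : Presentation A) : FreeGroup A → ℕ → ℕ → Prop
  | one : Area P 1 0 0
  | rel {r} : r ∈ P.rels → Area P (mk r) 1 r.length
  | inv {g n m} : Area P g n m → Area P g⁻¹ n m
  | mul {g h n m n' m'} : Area P g n m → Area P h n' m' → Area P (g * h) (n + n') (m + m')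
  | conj {g n m} (h) : Area P g n m → Area P (h * g * h⁻¹) n m

/-- `Disc P W v e f`: there is a van Kampen diagram over `P` with `v` vertices, `e` edges and `f`
faces, whose boundary, from a base point on, is labelled by `W`. It is described recursively by
deleting the first edge of the boundary. -/
inductive Disc (P : Presentation A) : Word A → ℕ → ℕ → ℕ → Prop
  | nil : Disc P [] 1 0 0
  | bridge {x W₁ W₂ v₁ e₁ f₁ v₂ e₂ f₂} : Disc P W₁ v₁ e₁ f₁ → Disc P W₂ v₂ e₂ f₂ →
      Disc P (x :: (W₁ ++ (x.1, !x.2) :: W₂)) (v₁ + v₂) (e₁ + e₂ + 1) (f₁ + f₂)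
  | face {x U W v e f} : Disc P (U ++ W) v e f → P.IsFaceLabel ((x.1, !x.2) :: U) →
      Disc P (x :: W) v (e + 1) (f + 1)

variable {P : Presentation A}

theorem Area.mem_closure {g : FreeGroup A} {n m : ℕ} (h : Area P g n m) : g ∈ P.closure := by
  induction h with
  | one => exact one_mem _
  | rel h => exact Subgroup.subset_normalClosure ⟨_, h, rfl⟩
  | inv _ ih => exact inv_mem ih
  | mul _ _ ih₁ ih₂ => exact mul_mem ih₁ ih₂
  | conj h _ ih =>
    exact (Subgroup.normalClosure_normal : (Subgroup.normalClosure _).Normal).conj_mem _ ih h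

theorem exists_area_of_mem_closure {g : FreeGroup A} (hg : g ∈ P.closure) :
    ∃ n m, Area P g n m := by
  let N : Subgroup (FreeGroup A) :=
    { carrier := {g | ∃ n m, Area P g n m}
      one_mem' := ⟨_, _, .one⟩
      mul_mem' := fun ⟨_, _, h⟩ ⟨_, _, h'⟩ => ⟨_, _, h.mul h'⟩
      inv_mem' := fun ⟨_, _, h⟩ => ⟨_, _, h.inv⟩ }
  have : N.Normal := ⟨fun _ ⟨_, _, h⟩ g => ⟨_, _, h.conj g⟩⟩
  have hle : P.closure ≤ N := by
    apply Subgroup.normalClosure_le_normal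
    rintro _ ⟨r, hr, rfl⟩
    exact ⟨_, _, .rel hr⟩
  exact hle hg

theorem Area.of_isFaceLabel {w : Word A} (h : P.IsFaceLabel w) : Area P (mk w) 1 w.length := by
  obtain ⟨r, ⟨k, rfl⟩, hr⟩ := h
  have hr' : Area P (mk r) 1 r.length := by
    rcases hr with hr | hr
    · exact .rel hr
    · have := (Area.rel hr).inv
      rwa [mk_invRev, inv_inv, FreeGroup.invRev_length] at this
  have key : mk (r.rotate k) =
      (mk (r.take (k % r.length)))⁻¹ * mk r * (mk (r.take (k % r.length)))⁻¹⁻¹ := by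
    have h : mk r = mk (r.take (k % r.length)) * mk (r.drop (k % r.length)) := by
      rw [← mk_append, List.take_append_drop]
    rw [List.rotate_eq_drop_append_take_mod, mk_append, h]
    group
  rw [key, List.length_rotate]
  exact hr'.conj _

theorem Disc.euler {W : Word A} {v e f : ℕ} (h : Disc P W v e f) : v + f = e + 1 := by
  induction h with
  | nil => rfl
  | bridge => omega
  | face => omega

/-- Here `m` is the total perimeter of the faces. A face glued along `x` contributes the inverse of
its label, conjugated by `x`; a bridge `x` conjugates the disc beyond it. -/
theorem Disc.area {W : Word A} {v e f : ℕ} (h : Disc P W v e f) :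
    ∃ m, Area P (mk W) f m ∧ 2 * e = W.length + m := by
  induction h with
  | nil => exact ⟨0, .one, rfl⟩
  | @bridge x W₁ W₂ _ _ _ _ _ _ _ _ ih₁ ih₂ =>
    obtain ⟨m₁, h₁, k₁⟩ := ih₁
    obtain ⟨m₂, h₂, k₂⟩ := ih₂
    refine ⟨m₁ + m₂, ?_, by simp; omega⟩
    have := (h₁.conj (mk [x])).mul h₂
    rwa [← mk_inv_letter, ← mk_append, ← mk_append, ← mk_append, List.append_assoc,
      List.append_assoc] at this
  | @face x U W _ _ _ _ hl ih =>
    obtain ⟨m, h, k⟩ := ih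
    have h₁ := ((Area.of_isFaceLabel hl).inv.conj (mk [x])).mul h
    have : mk [x] * (mk ((x.1, !x.2) :: U))⁻¹ * (mk [x])⁻¹ * mk (U ++ W) = mk (x :: W) := by
      rw [mk_cons (x.1, !x.2), mk_inv_letter, mk_append, mk_cons x W]
      group
    rw [this] at h₁
    refine ⟨_, by rwa [add_comm] at h₁, by simp at k ⊢; omega⟩

theorem Disc.mem_closure {W : Word A} {v e f : ℕ} (h : Disc P W v e f) : mk W ∈ P.closure :=
  let ⟨_, h, _⟩ := h.area
  h.mem_closure

/-- The surviving letter is followed backwards through the reduction: each cancelled pair lies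
wholly to its left or wholly to its right, so both sides stay trivial. -/
theorem red_singleton_split {L : Word A} {y : A × Bool} (h : FreeGroup.Red L [y]) :
    ∃ T₁ T₂, L = T₁ ++ y :: T₂ ∧ mk T₁ = 1 ∧ mk T₂ = 1 := by
  induction h using Relation.ReflTransGen.head_induction_on with
  | refl => exact ⟨[], [], rfl, rfl, rfl⟩
  | head h' _ ih =>
    obtain ⟨T₁, T₂, hT, h₁, h₂⟩ := ih
    cases h' with
    | @not L₁ L₂ a b =>
    have hab : mk ([(a, b)] ++ [(a, !b)]) = 1 := by
      rw [mk_append, mk_inv_letter (a, b), mul_inv_cancel]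
    rcases List.append_eq_append_iff.1 hT with ⟨c, rfl, rfl⟩ | ⟨c, rfl, hc⟩
    · refine ⟨L₁ ++ ([(a, b)] ++ [(a, !b)]) ++ c, T₂, by simp, ?_, h₂⟩
      rw [mk_append, mk_append, hab, mul_one, ← mk_append, h₁]
    · rcases List.cons_eq_append_iff.1 hc with ⟨rfl, rfl⟩ | ⟨c', rfl, rfl⟩
      · refine ⟨T₁ ++ ([(a, b)] ++ [(a, !b)]), T₂, by simp, ?_, h₂⟩
        rw [mk_append, hab, mul_one, h₁]
      · refine ⟨T₁, c' ++ ([(a, b)] ++ [(a, !b)]) ++ L₂, by simp, h₁, ?_⟩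
        rw [mk_append, mk_append, hab, mul_one, ← mk_append, h₂]

/-- The first letter of a trivial word has a partner with which it cancels. Finding where this
partner lies drives the construction of diagrams. -/
theorem mk_cons_eq_one_split {x : A × Bool} {T : Word A} (h : mk (x :: T) = 1) :
    ∃ T₁ T₂, T = T₁ ++ (x.1, !x.2) :: T₂ ∧ mk T₁ = 1 ∧ mk T₂ = 1 := by
  rw [FreeGroup.one_eq_mk, FreeGroup.Red.exact] at h
  obtain ⟨L, h₁, h₂⟩ := h
  obtain rfl := FreeGroup.Red.nil_iff.1 h₂
  exact red_singleton_split (FreeGroup.Red.cons_nil_iff_singleton.1 h₁)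

theorem append_eq_append_cons {a b s₁ s₂ : Word A} {y : A × Bool} (h : a ++ b = s₁ ++ y :: s₂) :
    (∃ c, a = s₁ ++ y :: c ∧ s₂ = c ++ b) ∨ ∃ c, s₁ = a ++ c ∧ b = c ++ y :: s₂ := by
  rcases List.append_eq_append_iff.1 h with ⟨c, rfl, hc⟩ | ⟨c, hc, hc'⟩
  · exact .inr ⟨c, rfl, hc⟩
  · rcases List.cons_eq_append_iff.1 hc' with ⟨rfl, hc'⟩ | ⟨c', rfl, rfl⟩
    · exact .inr ⟨[], by simpa using hc.symm, by simpa using hc'.symm⟩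
    · exact .inl ⟨c', hc, rfl⟩

/-- A letter, or a relator `r` conjugated by a word `g`, coded by the pair `(g, r)`. -/
abbrev Token (A : Type*) := (A × Bool) ⊕ (Word A × Word A)

/-! ### Van Kampen's lemma for lists of letters and conjugated relators -/

namespace Token

/-- The word that a token stands for. -/
def expand : Token A → Word A
  | .inl x => [x]
  | .inr (g, r) => g ++ r ++ invRev g

/-- The letters of a token. -/
def letters : Token A → Word A
  | .inl x => [x]
  | .inr _ => []

/-- The number of relators. -/
def relCount : Token A → ℕ
  | .inl _ => 0
  | .inr _ => 1

/-- The total length of the relators. -/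
def relLength : Token A → ℕ
  | .inl _ => 0
  | .inr (_, r) => r.length

/-- The number of letters, those of the conjugators included. -/
def size : Token A → ℕ
  | .inl _ => 1
  | .inr (g, _) => g.length

/-- The token is a letter or a conjugate of a relator of `P` or of its inverse. -/
def IsOver (P : Presentation A) : Token A → Prop
  | .inl _ => True
  | .inr (_, r) => r ∈ P.rels ∨ invRev r ∈ P.rels

/-- The sum of a numerical function over a list of tokens. -/
def sum (c : Token A → ℕ) (M : List (Token A)) : ℕ := (M.map c).sum

@[simp] theorem sum_nil (c : Token A → ℕ) : sum c [] = 0 := rfl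

@[simp] theorem sum_cons (c : Token A → ℕ) (t M) : sum c (t :: M) = c t + sum c M := by simp [sum]

@[simp] theorem sum_append (c : Token A → ℕ) (M M') : sum c (M ++ M') = sum c M + sum c M' := by
  simp [sum]

@[simp] theorem sum_map_inl (c : Token A → ℕ) (U : Word A) :
    sum c (U.map Sum.inl) = (U.map (fun x => c (.inl x))).sum := by simp [sum, Function.comp_def]

theorem flatMap_expand_inl (U : Word A) : (U.map Sum.inl).flatMap (expand (A := A)) = U := by
  induction U with
  | nil => rfl
  | cons x U ih => simp [expand, ih]

theorem flatMap_letters_inl (U : Word A) : (U.map Sum.inl).flatMap (letters (A := A)) = U := by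
  induction U with
  | nil => rfl
  | cons x U ih => simp [letters, ih]

theorem flatMap_eq_append_cons {M : List (Token A)} {T₁ T₂ : Word A} {y : A × Bool}
    (h : M.flatMap expand = T₁ ++ y :: T₂) :
    ∃ M₁ t M₂ s₁ s₂, M = M₁ ++ t :: M₂ ∧ expand t = s₁ ++ y :: s₂ ∧
      T₁ = M₁.flatMap expand ++ s₁ ∧ T₂ = s₂ ++ M₂.flatMap expand := by
  induction M generalizing T₁ with
  | nil => simp at h
  | cons t M ih =>
    rw [List.flatMap_cons] at h
    rcases append_eq_append_cons h with ⟨c, hc, rfl⟩ | ⟨c, rfl, hc⟩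
    · exact ⟨[], t, M, T₁, c, rfl, hc, by simp, rfl⟩
    · obtain ⟨M₁, t', M₂, s₁, s₂, rfl, h₁, rfl, rfl⟩ := ih hc
      exact ⟨t :: M₁, t', M₂, s₁, s₂, rfl, h₁, by simp, rfl⟩

theorem exists_leading_letter (M : List (Token A)) : M.flatMap letters = [] ∨
    ∃ C x M', M = C ++ .inl x :: M' ∧ C.flatMap letters = [] := by
  induction M with
  | nil => exact .inl rfl
  | cons t M ih =>
    rcases t with x | t
    · exact .inr ⟨[], x, M, rfl, rfl⟩
    · rcases ih with h | ⟨C, x, M', rfl, h⟩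
      · exact .inl (by simpa [letters] using h)
      · exact .inr ⟨.inr t :: C, x, M', rfl, by simpa [letters] using h⟩

/-- The first letter `x` cancels against an `x⁻¹` in the expansion of the rest. If this is a
boundary letter, the disc splits at a bridge. If it lies in a relator, a face is glued along `x` and
the relator is used up. If it lies in a conjugator, the conjugator can be shortened. Gluing a face
may increase the number of letters, hence the induction first on the relators and then on the size.
Relators left over when no letter remains are discarded, so the bounds are only inequalities. -/
theorem exists_disc (P : Presentation A) (N s : ℕ) : ∀ M : List (Token A),
    sum relCount M = N → sum size M = s → (∀ t ∈ M, t.IsOver P) → mk (M.flatMap expand) = 1 →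
    ∃ v e f, Disc P (M.flatMap letters) v e f ∧ f ≤ N ∧
      2 * e ≤ (M.flatMap letters).length + sum relLength M := by
  induction N using Nat.strong_induction_on generalizing s with
  | _ N ihN =>
  induction s using Nat.strong_induction_on with
  | _ s ihs =>
  -- a list which begins with a letter
  have key : ∀ (x : A × Bool) (M : List (Token A)),
      sum relCount M = N → sum size M + 1 = s → (∀ t ∈ M, t.IsOver P) →
      mk (x :: M.flatMap expand) = 1 →
      ∃ v e f, Disc P (x :: M.flatMap letters) v e f ∧ f ≤ N ∧
        2 * e ≤ (M.flatMap letters).length + 1 + sum relLength M := by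
    intro x M hN hs hP h1
    obtain ⟨T₁, T₂, hT, hT₁, hT₂⟩ := mk_cons_eq_one_split h1
    obtain ⟨M₁, t, M₂, s₁, s₂, rfl, ht, rfl, rfl⟩ := flatMap_eq_append_cons hT
    rw [mk_append] at hT₁ hT₂
    have hP₁ : ∀ t ∈ M₁, t.IsOver P := fun t h => hP t (by simp [h])
    have hP₂ : ∀ t ∈ M₂, t.IsOver P := fun t h => hP t (by simp [h])
    have hPt : t.IsOver P := hP t (by simp)
    -- replace the conjugator by a shorter one
    have shorten : ∀ (M' : List (Token A)), sum relCount M' = N → sum size M' + 1 < s →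
        (∀ t ∈ M', t.IsOver P) → mk (x :: M'.flatMap expand) = 1 →
        M'.flatMap letters = (M₁ ++ t :: M₂).flatMap letters →
        sum relLength M' = sum relLength (M₁ ++ t :: M₂) →
        ∃ v e f, Disc P (x :: (M₁ ++ t :: M₂).flatMap letters) v e f ∧ f ≤ N ∧
          2 * e ≤ ((M₁ ++ t :: M₂).flatMap letters).length + 1 +
            sum relLength (M₁ ++ t :: M₂) := by
      intro M' h₁ h₂ h₃ h₄ h₅ h₆
      obtain ⟨v, e, f, hd, hf, he⟩ := ihs (sum size M' + 1) h₂ (.inl x :: M')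
        (by simpa [relCount] using h₁) (by simp [size, add_comm])
        (by simpa [IsOver] using h₃) (by simpa [expand] using h₄)
      rw [← h₅, ← h₆]
      exact ⟨v, e, f, by simpa [letters] using hd, hf, by simpa [letters, relLength] using he⟩
    rcases t with y | ⟨g, r⟩
    · have : s₁ = [] ∧ y = (x.1, !x.2) ∧ s₂ = [] := by
        have := congrArg List.length ht
        simp [expand] at this
        obtain ⟨rfl, rfl⟩ : s₁ = [] ∧ s₂ = [] := by
          constructor <;> apply List.eq_nil_of_length_eq_zero <;> omega
        simpa [expand] using ht
      obtain ⟨rfl, rfl, rfl⟩ := this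
      simp [size, relCount] at hN hs
      have sub : ∀ M', sum relCount M' ≤ N → sum size M' < s → (∀ t ∈ M', t.IsOver P) →
          mk (M'.flatMap expand) = 1 → ∃ v e f, Disc P (M'.flatMap letters) v e f ∧
            f ≤ sum relCount M' ∧ 2 * e ≤ (M'.flatMap letters).length + sum relLength M' := by
        intro M' h₁ h₂ h₃ h₄
        rcases h₁.lt_or_eq with h₁ | h₁
        · exact ihN _ h₁ _ M' rfl rfl h₃ h₄
        · obtain ⟨v, e, f, hd, hf, he⟩ := ihs _ h₂ M' h₁ rfl h₃ h₄
          exact ⟨v, e, f, hd, by omega, he⟩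
      obtain ⟨v₁, e₁, f₁, hd₁, hf₁, he₁⟩ :=
        sub M₁ (by omega) (by omega) hP₁ (by simpa [← FreeGroup.one_eq_mk] using hT₁)
      obtain ⟨v₂, e₂, f₂, hd₂, hf₂, he₂⟩ :=
        sub M₂ (by omega) (by omega) hP₂ (by simpa [← FreeGroup.one_eq_mk] using hT₂)
      refine ⟨_, _, _, by simpa [letters] using Disc.bridge (x := x) hd₁ hd₂, by omega, ?_⟩
      simp [letters, relLength] at *
      omega
    · simp only [expand] at ht
      have hs' : sum size M₁ + g.length + sum size M₂ + 1 = s := by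
        simp [size] at hs; omega
      have hN' : sum relCount M₁ + sum relCount M₂ + 1 = N := by
        simp [relCount] at hN; omega
      have hPc : ∀ c, IsOver P (.inr (c, r)) := fun _ => hPt
      have hx : ∀ c, mk ((x.1, !x.2) :: c) = (mk [x])⁻¹ * mk c := fun c => by
        rw [mk_cons, mk_inv_letter]
      rcases append_eq_append_cons ht with ⟨c, hc, rfl⟩ | ⟨c, rfl, hc⟩
      · rcases append_eq_append_cons hc with ⟨c, rfl, rfl⟩ | ⟨d, rfl, rfl⟩
        · apply shorten (M₁ ++ M₂ ++ [.inr (c, r)])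
          · simp [relCount]; omega
          · simp [size] at hs' ⊢; omega
          · simp only [List.mem_append, List.mem_singleton]
            rintro t ((h | h) | rfl)
            exacts [hP₁ t h, hP₂ t h, hPc c]
          · have e₁ := eq_inv_of_mul_eq_one_left hT₁
            have e₂ := eq_inv_of_mul_eq_one_right hT₂
            rw [mk_cons, List.flatMap_append, List.flatMap_append, mk_append, mk_append, e₁, e₂]
            simp only [List.flatMap_cons, List.flatMap_nil, List.append_nil, expand, mk_append,
              mk_invRev, hx]
            group
          · simp only [List.flatMap_append, List.flatMap_cons, letters, List.flatMap_nil,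
              List.append_nil, List.nil_append]
          · simp [relLength]; omega
        -- The partner lies in the relator, `r = d x⁻¹ c`: a face labelled `x⁻¹ c d` is glued along
        -- `x`, and `c d` replaces `x` on the boundary.
        · obtain ⟨v, e, f, hd, hf, he⟩ := ihN (N - 1) (by omega) _
            ((c ++ d).map Sum.inl ++ M₁ ++ M₂)
            (by
              rw [sum_append, sum_append, sum_map_inl]
              simp only [relCount, List.map_const', List.sum_replicate_nat]
              omega) rfl
            (by
              simp only [List.mem_append, List.mem_map]
              rintro t ((⟨x, -, rfl⟩ | h) | h)
              exacts [trivial, hP₁ t h, hP₂ t h])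
            (by
              have e₁ := eq_inv_of_mul_eq_one_left hT₁
              have e₂ := eq_inv_of_mul_eq_one_right hT₂
              rw [List.flatMap_append, List.flatMap_append, flatMap_expand_inl, mk_append,
                mk_append, e₁, e₂, mk_append, mk_append, mk_append, mk_invRev]
              group)
          have hl : P.IsFaceLabel ((x.1, !x.2) :: (c ++ d)) :=
            ⟨_, ⟨d.length, by rw [List.rotate_append_length_eq]; rfl⟩, hPt⟩
          rw [List.flatMap_append, List.flatMap_append, flatMap_letters_inl] at hd he
          rw [List.append_assoc] at hd
          refine ⟨v, e + 1, f + 1, ?_, by omega, ?_⟩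
          · rw [List.flatMap_append, List.flatMap_cons]
            exact hd.face hl
          · rw [sum_append, sum_append, sum_map_inl] at he
            rw [List.flatMap_append, List.flatMap_cons, sum_append, sum_cons]
            simp only [relLength, letters, List.length_append, List.length_cons, List.nil_append,
              List.map_const', List.sum_replicate_nat] at he ⊢
            omega
      -- The partner lies in the inverse conjugator, `g⁻¹ = c x⁻¹ s₂`: the shorter conjugator is
      -- `c⁻¹`, and the token moves to the front.
      · apply shorten (.inr (invRev c, r) :: (M₁ ++ M₂))
        · simp [relCount]; omega
        · have := congrArg List.length hc
          rw [FreeGroup.invRev_length, List.length_append, List.length_cons] at this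
          rw [sum_cons, sum_append, size, FreeGroup.invRev_length]; omega
        · simp only [List.mem_cons, List.mem_append]
          rintro t (rfl | h | h)
          exacts [hPc _, hP₁ t h, hP₂ t h]
        · have e₁ := eq_inv_of_mul_eq_one_left hT₁
          have e₂ := eq_inv_of_mul_eq_one_right hT₂
          have e₃ : mk g = (mk (invRev g))⁻¹ := by rw [mk_invRev, inv_inv]
          rw [mk_cons, List.flatMap_cons, List.flatMap_append, mk_append, mk_append, e₁, e₂]
          simp only [expand, mk_append, e₃, hc, mk_invRev, hx]
          group
        · simp only [List.flatMap_append, List.flatMap_cons, letters, List.nil_append]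
        · simp [relLength]; omega
  intro M hN hs hP h1
  rcases exists_leading_letter M with h | ⟨C, x, M', rfl, hC⟩
  · rw [h]
    exact ⟨1, 0, 0, .nil, by omega, by simp⟩
  -- A cyclic shift of a trivial product is trivial, so the relators before the first letter may
  -- move to the end.
  · obtain ⟨v, e, f, hd, hf, he⟩ := key x (M' ++ C)
      (by simp [relCount] at hN ⊢; omega) (by simp [size] at hs ⊢; omega)
      (by
        intro t ht
        refine hP t ?_
        simp at ht ⊢
        tauto)
      (by
        rw [List.flatMap_append, List.flatMap_cons, mk_append, mk_append] at h1
        rw [mk_cons, List.flatMap_append, mk_append, ← mul_assoc]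
        exact mul_eq_one_iff_eq_inv.2 (eq_inv_of_mul_eq_one_right h1))
    rw [List.flatMap_append, hC, List.append_nil] at hd he
    rw [sum_append] at he
    refine ⟨v, e, f, by simpa [hC, letters] using hd, hf, ?_⟩
    simp [hC, letters, relLength] at he ⊢
    omega

end Token

theorem Area.exists_tokens {g : FreeGroup A} {n m : ℕ} (h : Area P g n m) :
    ∃ M : List (Token A), mk (M.flatMap Token.expand) = g ∧ (∀ t ∈ M, t.IsOver P) ∧
      M.flatMap Token.letters = [] ∧ Token.sum Token.relCount M = n ∧
      Token.sum Token.relLength M = m := by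
  induction h with
  | one => exact ⟨[], rfl, by simp, rfl, rfl, rfl⟩
  | @rel r hr =>
    exact ⟨[.inr ([], r)], by simp [Token.expand], by simpa [Token.IsOver] using .inl hr, rfl,
      rfl, rfl⟩
  | inv _ ih =>
    obtain ⟨M, rfl, hP, hl, rfl, rfl⟩ := ih
    clear * - hP hl
    induction M with
    | nil => exact ⟨[], rfl, by simp, rfl, rfl, rfl⟩
    | cons t M ih =>
      rcases t with x | ⟨c, r⟩
      · simp [Token.letters] at hl
      · obtain ⟨M', h₁, h₂, h₃, h₄, h₅⟩ := ih (fun t ht => hP t (by simp [ht]))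
          (by simpa [Token.letters] using hl)
        refine ⟨M' ++ [.inr (c, invRev r)], ?_, ?_, ?_, ?_, ?_⟩
        · simp only [List.flatMap_append, List.flatMap_cons, List.flatMap_nil, mk_append, h₁,
            Token.expand, mk_invRev, List.append_nil]
          group
        · simp only [List.mem_append, List.mem_singleton]
          rintro t (ht | rfl)
          · exact h₂ t ht
          · have : r ∈ P.rels ∨ invRev r ∈ P.rels := hP (.inr (c, r)) (by simp)
            simpa [Token.IsOver] using this.symm
        · simpa [Token.letters] using h₃
        · simp [h₄, Token.relCount, add_comm]
        · simp [h₅, Token.relLength, add_comm]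
  | mul _ _ ih₁ ih₂ =>
    obtain ⟨M, rfl, hP, hl, rfl, rfl⟩ := ih₁
    obtain ⟨M', rfl, hP', hl', rfl, rfl⟩ := ih₂
    refine ⟨M ++ M', by rw [List.flatMap_append, mk_append], ?_, by rw [List.flatMap_append, hl, hl']; rfl, by simp,
      by simp⟩
    intro t ht
    rcases List.mem_append.1 ht with ht | ht
    exacts [hP t ht, hP' t ht]
  | conj b _ ih =>
    obtain ⟨M, rfl, hP, hl, rfl, rfl⟩ := ih
    obtain ⟨w, rfl⟩ : ∃ w, mk w = b := Quot.exists_rep b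
    clear * - hP hl
    induction M with
    | nil => exact ⟨[], by simp only [List.flatMap_nil, ← FreeGroup.one_eq_mk, mul_one, mul_inv_cancel],
        by simp, rfl, rfl, rfl⟩
    | cons t M ih =>
      rcases t with x | ⟨c, r⟩
      · simp [Token.letters] at hl
      · obtain ⟨M', h₁, h₂, h₃, h₄, h₅⟩ := ih (fun t ht => hP t (by simp [ht]))
          (by simpa [Token.letters] using hl)
        refine ⟨.inr (w ++ c, r) :: M', ?_, ?_, ?_, ?_, ?_⟩
        · simp only [List.flatMap_cons, mk_append, h₁, Token.expand, mk_invRev]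
          group
        · simp only [List.mem_cons]
          rintro t (rfl | ht)
          · exact hP (.inr (c, r)) (by simp)
          · exact h₂ t ht
        · simpa [Token.letters] using h₃
        · simp [h₄, Token.relCount]
        · simp [h₅, Token.relLength]

/-- Van Kampen's lemma. -/
theorem Area.exists_disc {W : Word A} {n m : ℕ} (h : Area P (mk W) n m) :
    ∃ v e f, Disc P W v e f ∧ f ≤ n ∧ 2 * e ≤ W.length + m := by
  -- Tokens for the inverse of `W` make the list of the letters of `W` followed by `M` trivial.
  obtain ⟨M, h₁, h₂, h₃, h₄, h₅⟩ := h.inv.exists_tokens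
  obtain ⟨v, e, f, hd, hf, he⟩ := Token.exists_disc P n _ (W.map Sum.inl ++ M)
    (by
      rw [Token.sum_append, Token.sum_map_inl, h₄]
      simp [Token.relCount]) rfl
    (by
      simp only [List.mem_append, List.mem_map]
      rintro t (⟨x, -, rfl⟩ | ht)
      exacts [trivial, h₂ t ht])
    (by rw [List.flatMap_append, Token.flatMap_expand_inl, mk_append, h₁, mul_inv_cancel])
  rw [List.flatMap_append, Token.flatMap_letters_inl, h₃, List.append_nil] at hd he
  rw [Token.sum_append, Token.sum_map_inl, h₅] at he
  exact ⟨v, e, f, hd, hf, by simpa [Token.relLength] using he⟩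

theorem exists_disc_of_mem_closure {W : Word A} (h : mk W ∈ P.closure) :
    ∃ v e f, Disc P W v e f := by
  obtain ⟨n, m, h⟩ := exists_area_of_mem_closure h
  obtain ⟨v, e, f, h, -, -⟩ := h.exists_disc
  exact ⟨v, e, f, h⟩

/-- A relator counts once in `n` and with its length in `m`; hence an absolute bound on the first
count and a bound relative to `r.length` on the second. -/
theorem Area.change_relators {P' : Presentation A} {K : ℕ}
    (hK : ∀ r ∈ P.rels, ∃ n m, Area P' (mk r) n m ∧ n ≤ K ∧ m ≤ K * r.length)
    {g : FreeGroup A} {n m : ℕ} (h : Area P g n m) :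
    ∃ n' m', Area P' g n' m' ∧ n' ≤ K * n ∧ m' ≤ K * m := by
  induction h with
  | one => exact ⟨0, 0, .one, by omega, by omega⟩
  | rel hr => simpa using hK _ hr
  | inv _ ih =>
    obtain ⟨n', m', h, h₁, h₂⟩ := ih
    exact ⟨n', m', h.inv, h₁, h₂⟩
  | mul _ _ ih₁ ih₂ =>
    obtain ⟨n₁, m₁, h₁, k₁, l₁⟩ := ih₁
    obtain ⟨n₂, m₂, h₂, k₂, l₂⟩ := ih₂
    exact ⟨_, _, h₁.mul h₂, by rw [mul_add]; omega, by rw [mul_add]; omega⟩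
  | conj b _ ih =>
    obtain ⟨n', m', h, h₁, h₂⟩ := ih
    exact ⟨n', m', h.conj b, h₁, h₂⟩

end Algebra
-- Removing points from the cycles of a permutation and inserting them
section Permutations

open Equiv Equiv.Perm

variable {D : Type*}

/-- A map that sends consecutive points of `φ` to points on a common cycle of `ψ` sends cycles of
`φ` into cycles of `ψ`. -/
theorem sameCycle_map {D' : Type*} {φ : Perm D} {ψ : Perm D'} (r : D → D')
    (h : ∀ y, ψ.SameCycle (r y) (r (φ y))) {y z : D} (hyz : φ.SameCycle y z) :
    ψ.SameCycle (r y) (r z) := by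
  obtain ⟨i, rfl⟩ := hyz
  induction i using Int.induction_on with
  | zero => exact .refl _ _
  | succ i ih =>
    rw [add_comm, zpow_add, zpow_one, mul_apply]
    exact ih.trans (h _)
  | pred i ih =>
    refine ih.trans (SameCycle.symm ?_)
    have := h ((φ ^ (-(i : ℤ) - 1)) y)
    rwa [← mul_apply, ← zpow_one_add, add_sub_cancel] at this

theorem sameCycle_mem_iff {φ : Perm D} {Q : D → Prop} (h : ∀ y, Q (φ y) ↔ Q y) {y z : D}
    (hyz : φ.SameCycle y z) : Q y ↔ Q z := by
  obtain ⟨i, rfl⟩ := hyz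
  induction i using Int.induction_on with
  | zero => rfl
  | succ i ih =>
    rw [add_comm, zpow_add, zpow_one, mul_apply, h]
    exact ih
  | pred i ih =>
    rw [ih, ← h ((φ ^ (-(i : ℤ) - 1)) y), ← mul_apply, ← zpow_one_add, add_sub_cancel]

theorem sameCycle_of_semiconj {D' : Type*} {φ : Perm D} {ψ : Perm D'} {ι : D' → D}
    (hι : Function.Injective ι) (h : ∀ y, ι (ψ y) = φ (ι y)) {y z : D'}
    (hyz : φ.SameCycle (ι y) (ι z)) : ψ.SameCycle y z := by
  obtain ⟨i, hi⟩ := hyz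
  refine ⟨i, hι ?_⟩
  rw [← hi]
  clear hi
  induction i using Int.induction_on with
  | zero => rfl
  | succ i ih => rw [add_comm, zpow_add, zpow_add, zpow_one, zpow_one, mul_apply, mul_apply, h, ih]
  | pred i ih =>
    apply φ.injective
    rw [← h, ← mul_apply, ← mul_apply, ← zpow_one_add, ← zpow_one_add, add_sub_cancel, ih]

variable [DecidableEq D]

/-- Remove the point `x` from its cycle. -/
def skip (x : D) (φ : Perm D) : Perm D := swap x (φ x) * φ

theorem skip_apply (x : D) (φ : Perm D) (y : D) :
    skip x φ y = if y = x then x else if φ y = x then φ x else φ y := by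
  by_cases h : y = x
  · subst h; simp [skip]
  · by_cases h' : φ y = x
    · simp [skip, h, h']
    · simp only [skip, h, h', if_false, mul_apply]
      exact swap_apply_of_ne_of_ne h' fun h'' => h (φ.injective h'')

theorem skip_sameCycle {x : D} {φ : Perm D} {y z : D} (hy : y ≠ x) (hz : z ≠ x)
    (h : φ.SameCycle y z) : (skip x φ).SameCycle y z := by
  have := sameCycle_map (ψ := skip x φ) (fun y => if y = x then φ x else y) ?_ h
  · simpa [hy, hz] using this
  · intro y
    by_cases h₁ : y = x
    · subst h₁
      by_cases h₂ : φ y = y <;> simp [h₂, Equiv.Perm.SameCycle.refl]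
    · by_cases h₂ : φ y = x
      · refine ⟨1, ?_⟩
        simp [skip_apply, h₁, h₂]
      · refine ⟨1, ?_⟩
        simp [skip_apply, h₁, h₂]

/-- Insert the fixed point `x` before `c` in the cycle of `c`. -/
def insertBefore (c x : D) (φ : Perm D) : Perm D := swap c x * φ

theorem insertBefore_apply {c x : D} {φ : Perm D} (hx : φ x = x) (y : D) :
    insertBefore c x φ y = if φ y = c then x else if y = x then c else φ y := by
  by_cases h : φ y = c
  · simp [insertBefore, h]
  · by_cases h' : y = x
    · subst h'; simp [insertBefore, hx, eq_comm]
    · have : φ y ≠ x := fun k => h' (φ.injective (k.trans hx.symm))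
      simp [insertBefore, h, h', swap_apply_of_ne_of_ne, this]

theorem insertBefore_sameCycle_self {c x : D} {φ : Perm D} (hx : φ x = x) :
    (insertBefore c x φ).SameCycle x c := by
  by_cases h : x = c
  · rw [h]
  · exact ⟨1, by simp [insertBefore_apply hx, hx, h]⟩

theorem insertBefore_sameCycle {c x : D} {φ : Perm D} (hx : φ x = x) {y z : D}
    (h : φ.SameCycle y z) : (insertBefore c x φ).SameCycle y z := by
  refine sameCycle_map id (fun y => ?_) h
  by_cases h₁ : φ y = c
  · rw [id, id, h₁]
    exact SameCycle.trans ⟨1, by simp [insertBefore_apply hx, h₁]⟩ (insertBefore_sameCycle_self hx)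
  · by_cases h₂ : y = x
    · subst h₂; simp [hx, SameCycle.refl]
    · exact ⟨1, by simp [insertBefore_apply hx, h₁, h₂]⟩

/-- The points with `s` are permuted by `φ`, and two of them lie on a common cycle if they have the
same image under `o`; the other points are fixed. -/
structure IsRotationSystem {V : Type*} (φ : Perm D) (s : D → Prop) (o : D → V) : Prop where
  mem_iff : ∀ y, s (φ y) ↔ s y
  map_eq : ∀ y, s y → o (φ y) = o y
  sameCycle : ∀ y z, s y → s z → o y = o z → φ.SameCycle y z
  fixed : ∀ y, ¬ s y → φ y = y

/-- The alternative `c = x` covers a vertex without edges so far: the insertion is then the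
identity, and `x` alone is the cycle of its vertex. -/
theorem IsRotationSystem.insertBefore {V : Type*} {φ : Perm D} {s : D → Prop} {o o' : D → V}
    (h : IsRotationSystem φ s o) {c x : D} (hx : ¬ s x) (ho : ∀ y, s y → o' y = o y)
    (hc : s c ∧ o c = o' x ∨ c = x ∧ ∀ y, s y → o y ≠ o' x) :
    IsRotationSystem (insertBefore c x φ) (fun y => s y ∨ y = x) o' := by
  have hfx := h.fixed x hx
  have hcyc : ∀ y, s y → o' y = o' x → (DehnPres.insertBefore c x φ).SameCycle x y := by
    intro y hy hyx
    rw [ho y hy] at hyx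
    rcases hc with ⟨hc, hcx⟩ | ⟨-, hcx⟩
    · exact (insertBefore_sameCycle_self hfx).trans
        (insertBefore_sameCycle hfx (h.sameCycle c y hc hy (hcx.trans hyx.symm)))
    · exact (hcx y hy hyx).elim
  constructor
  · intro y
    rw [insertBefore_apply hfx]
    split_ifs with h₁ h₂
    · rcases hc with ⟨hc, -⟩ | ⟨rfl, -⟩
      · rw [← h.mem_iff y, h₁]
        simp [hc]
      · simp [φ.injective (h₁.trans hfx.symm)]
    · subst h₂
      rcases hc with ⟨hc, -⟩ | ⟨rfl, -⟩ <;> simp [*]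
    · have : φ y ≠ x := fun k => h₂ (φ.injective (k.trans hfx.symm))
      simp [h₂, this, h.mem_iff]
  · intro y hy
    rw [insertBefore_apply hfx]
    split_ifs with h₁ h₂
    · rcases hc with ⟨hc, hcx⟩ | ⟨rfl, -⟩
      · have hy' : s y := by rwa [← h.mem_iff, h₁]
        rw [← hcx, ho y hy', ← h.map_eq y hy', h₁]
      · rw [φ.injective (h₁.trans hfx.symm)]
    · subst h₂
      rcases hc with ⟨hc, hcx⟩ | ⟨rfl, -⟩
      · rw [ho c hc, hcx]
      · rfl
    · have hy' := hy.resolve_right h₂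
      rw [ho y hy', ho _ ((h.mem_iff y).2 hy'), h.map_eq y hy']
  · rintro y z (hy | rfl) (hz | rfl) hyz
    · rw [ho y hy, ho z hz] at hyz
      exact insertBefore_sameCycle hfx (h.sameCycle y z hy hz hyz)
    · exact (hcyc y hy hyz).symm
    · exact hcyc z hz hyz.symm
    · exact .refl _ _
  · intro y hy
    simp only [not_or] at hy
    have hyf := h.fixed y hy.1
    rw [insertBefore_apply hfx, if_neg hy.2, hyf, if_neg]
    rintro rfl
    rcases hc with ⟨hc, -⟩ | ⟨hc, -⟩
    exacts [hy.1 hc, hy.2 hc]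

omit [DecidableEq D] in
theorem isCycleOn_fiber {V : Type*} {φ : Perm D} {o : D → V} (h₁ : ∀ d, o (φ d) = o d)
    (h₂ : ∀ d d', o d = o d' → φ.SameCycle d d') (v : V) : φ.IsCycleOn {d | o d = v} := by
  refine ⟨⟨fun d hd => (h₁ d).trans hd, φ.injective.injOn, fun d hd => ⟨φ.symm d, ?_, by simp⟩⟩,
    fun d hd d' hd' => h₂ d d' (Eq.trans hd hd'.symm)⟩
  have := h₁ (φ.symm d)
  rw [apply_symm_apply] at this
  exact this.symm.trans hd

end Permutations

/-! ### Closed walks as lists -/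

section Walks

variable {D : Type*}

/-- The list `p` runs once through the points with `s`, each followed by its image under `σ`, the
last by the first one. -/
structure IsWalk (σ : D → D) (s : D → Prop) (p : List D) : Prop where
  nodup : p.Nodup
  mem_iff : ∀ d, d ∈ p ↔ s d
  map_eq : p.map σ = p.rotate 1

theorem IsWalk.rotate {σ : D → D} {s : D → Prop} {p : List D} (h : IsWalk σ s p) (n : ℕ) :
    IsWalk σ s (p.rotate n) :=
  ⟨List.nodup_rotate.2 h.nodup, fun d => by rw [List.mem_rotate, h.mem_iff],
    by rw [List.map_rotate, h.map_eq, List.rotate_rotate, List.rotate_rotate, add_comm]⟩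

theorem IsWalk.of_isRotated {σ : D → D} {s : D → Prop} {p q : List D} (h : IsWalk σ s p)
    (hq : p.IsRotated q) : IsWalk σ s q := by
  obtain ⟨n, rfl⟩ := hq
  exact h.rotate n

theorem IsWalk.map_mem {σ : D → D} {s : D → Prop} {p : List D} (h : IsWalk σ s p) {d : D}
    (hd : s d) : s (σ d) := by
  rw [← h.mem_iff] at hd ⊢
  have := List.mem_map_of_mem (f := σ) hd
  rwa [h.map_eq, List.mem_rotate] at this

theorem exists_isRotated_cons {p : List D} {d : D} (hd : d ∈ p) : ∃ l, p.IsRotated (d :: l) := by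
  obtain ⟨a, b, rfl⟩ := List.append_of_mem hd
  exact ⟨b ++ a, a.length, by rw [List.rotate_append_length_eq]; rfl⟩

theorem IsWalk.exists_cons {σ : D → D} {s : D → Prop} {p : List D} (h : IsWalk σ s p) {d : D}
    (hd : s d) : ∃ l, p.IsRotated (d :: l) ∧ IsWalk σ s (d :: l) := by
  obtain ⟨l, hl⟩ := exists_isRotated_cons ((h.mem_iff d).2 hd)
  exact ⟨l, hl, h.of_isRotated hl⟩

theorem IsWalk.cons_map_eq {σ : D → D} {s : D → Prop} {d : D} {l : List D}
    (h : IsWalk σ s (d :: l)) : σ d :: l.map σ = l ++ [d] := by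
  simpa using h.map_eq

/-- The equation says that `σ` leads from `a` through `l` to `b`. Nothing is asked of `Q` at `a`,
which in the applications is often an orientation of a deleted edge. -/
theorem chain_forall {σ : D → D} {Q : D → Prop} {a b : D} {l : List D}
    (h : σ a :: l.map σ = l ++ [b]) (ha : Q (σ a)) (hl : ∀ y ∈ l, Q y → Q (σ y)) :
    (∀ y ∈ l, Q y) ∧ Q b := by
  induction l generalizing a with
  | nil => simp at h; subst h; simpa using ha
  | cons c l ih =>
    simp only [List.map_cons, List.cons_append, List.cons.injEq] at h
    obtain ⟨rfl, h⟩ := h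
    have := ih h (hl _ (by simp) ha) fun y hy => hl y (by simp [hy])
    exact ⟨by simpa using ⟨ha, this.1⟩, this.2⟩

theorem IsWalk.forall_iff {σ : D → D} {s Q : D → Prop} {p : List D} (h : IsWalk σ s p)
    (hQ : ∀ y, s y → (Q (σ y) ↔ Q y)) {y z : D} (hy : s y) (hz : s z) : Q y ↔ Q z := by
  have key : ∀ y z, s y → s z → Q y → Q z := by
    intro y z hy hz hQy
    obtain ⟨l, -, hl⟩ := h.exists_cons hy
    have := chain_forall (Q := Q) hl.cons_map_eq ((hQ y hy).2 hQy)
      fun x hx => (hQ x ((hl.mem_iff x).1 (by simp [hx]))).2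
    rcases List.mem_cons.1 ((hl.mem_iff z).2 hz) with rfl | hz
    exacts [hQy, this.1 z hz]
  exact ⟨key y z hy hz, key z y hz hy⟩

theorem IsWalk.sameCycle {σ : Equiv.Perm D} {s : D → Prop} {p : List D} (h : IsWalk σ s p)
    {y z : D} (hy : s y) (hz : s z) : σ.SameCycle y z :=
  (h.forall_iff (Q := fun x => σ.SameCycle y x) (fun _ _ => Equiv.Perm.sameCycle_apply_right)
    hy hz).1 (.refl _ _)

end Walks

/-! ### Maps on closed oriented surfaces, with cells in ambient types -/

section PlaneMaps

variable {A : Type*} {V E F : Type}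

@[simp] theorem reversal_apply (d : E × Bool) : reversal E d = (d.1, !d.2) := rfl

/-- The oriented edge that follows `d` on the boundary of the region on its left, given the
cyclic orders around the vertices. -/
def follow (φ : Equiv.Perm (E × Bool)) (d : E × Bool) : E × Bool := φ (d.1, !d.2)

/-- The word read along a path. -/
def pathWord (lab : E → A) (p : List (E × Bool)) : Word A := p.map fun d => (lab d.1, d.2)

/-- Inside of ambient types, the finite sets `Vs`, `Es` and `Fs` are the cells of a connected
complex on a closed oriented surface, with cyclic orders `φ` around the vertices. The faces are
labelled by relators of `P`, up to cyclic shift and direction, and `p` is the boundary walk of the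
outer region. -/
structure IsSurfaceMap (P : Presentation A) (lab : E → A) (org : E × Bool → V)
    (φ : Equiv.Perm (E × Bool)) (reg : E × Bool → Option F) (Vs : Finset V) (Es : Finset E)
    (Fs : Finset F) (p : List (E × Bool)) : Prop where
  org_mem : ∀ d, d.1 ∈ Es → org d ∈ Vs
  reg_mem : ∀ d, d.1 ∈ Es → ∀ f, reg d = some f → f ∈ Fs
  mem_iff : ∀ d, (φ d).1 ∈ Es ↔ d.1 ∈ Es
  org_eq : ∀ d, d.1 ∈ Es → org (φ d) = org d
  sameCycle : ∀ d d', d.1 ∈ Es → d'.1 ∈ Es → org d = org d' → φ.SameCycle d d'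
  outer : IsWalk (follow φ) (fun d => d.1 ∈ Es ∧ reg d = none) p
  faces : ∀ f ∈ Fs, ∃ q, IsWalk (follow φ) (fun d => d.1 ∈ Es ∧ reg d = some f) q ∧
    P.IsFaceLabel (pathWord lab q)
  outer_ne : Es.Nonempty → p ≠ []
  nonempty : Vs.Nonempty
  connected : ∀ S : V → Prop, (∀ d, d.1 ∈ Es → (S (org d) ↔ S (org (d.1, !d.2)))) →
    ∀ u ∈ Vs, ∀ v ∈ Vs, S u → S v

theorem Presentation.IsFaceLabel.ne_nil {P : Presentation A} {w : Word A} (h : P.IsFaceLabel w) :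
    w ≠ [] := by
  rintro rfl
  obtain ⟨r, hr, h⟩ := h
  obtain rfl := List.isRotated_nil_iff.1 hr
  rcases h with h | h
  exacts [P.rels_ne_nil _ h rfl, P.rels_ne_nil _ h rfl]

namespace IsSurfaceMap

variable {P : Presentation A} {lab : E → A} {org : E × Bool → V} {φ : Equiv.Perm (E × Bool)}
  {reg : E × Bool → Option F} {Vs : Finset V} {Es : Finset E} {Fs : Finset F}
  {p : List (E × Bool)}

theorem exists_walk (h : IsSurfaceMap P lab org φ reg Vs Es Fs p) {d : E × Bool} (hd : d.1 ∈ Es) :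
    ∃ q, IsWalk (follow φ) (fun y => y.1 ∈ Es ∧ reg y = reg d) q := by
  rcases hr : reg d with _ | f
  · exact ⟨p, h.outer⟩
  · obtain ⟨q, hq, -⟩ := h.faces f (h.reg_mem d hd f hr)
    exact ⟨q, hq⟩

theorem follow_mem (h : IsSurfaceMap P lab org φ reg Vs Es Fs p) {d : E × Bool} (hd : d.1 ∈ Es) :
    (follow φ d).1 ∈ Es := (h.mem_iff _).2 hd

theorem reg_follow (h : IsSurfaceMap P lab org φ reg Vs Es Fs p) {d : E × Bool} (hd : d.1 ∈ Es) :
    reg (follow φ d) = reg d := by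
  obtain ⟨q, hq⟩ := h.exists_walk hd
  exact (hq.map_mem (d := d) ⟨hd, rfl⟩).2

theorem org_follow (h : IsSurfaceMap P lab org φ reg Vs Es Fs p) {d : E × Bool} (hd : d.1 ∈ Es) :
    org (follow φ d) = org (d.1, !d.2) := h.org_eq _ hd

theorem exists_dart (h : IsSurfaceMap P lab org φ reg Vs Es Fs p) {f : F} (hf : f ∈ Fs) :
    ∃ d : E × Bool, d.1 ∈ Es ∧ reg d = some f := by
  obtain ⟨q, hq, hl⟩ := h.faces f hf
  rcases q with _ | ⟨d, q⟩
  · exact (hl.ne_nil rfl).elim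
  · exact ⟨d, (hq.mem_iff d).1 (by simp)⟩

/-- The inclusion of the oriented edges of the map into the ambient type. -/
def dartVal (d : Es × Bool) : E × Bool := (d.1, d.2)

theorem dartVal_injective : Function.Injective (dartVal (Es := Es)) := by
  rintro ⟨⟨a, ha⟩, b⟩ ⟨⟨c, hc⟩, d⟩ h
  simpa [dartVal] using h

theorem exists_map_dartVal {q : List (E × Bool)} (hq : ∀ d ∈ q, d.1 ∈ Es) :
    ∃ q' : List (Es × Bool), q'.map dartVal = q := by
  induction q with
  | nil => exact ⟨[], rfl⟩
  | cons d q ih =>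
    obtain ⟨q', rfl⟩ := ih fun d hd => hq d (by simp [hd])
    exact ⟨(⟨d.1, hq d (by simp)⟩, d.2) :: q', rfl⟩

/-- The boundary permutation of the oriented edges of the map. -/
noncomputable def next (h : IsSurfaceMap P lab org φ reg Vs Es Fs p) : Equiv.Perm (Es × Bool) :=
  Equiv.ofBijective
    (fun d => (⟨(follow φ (dartVal d)).1, h.follow_mem d.1.2⟩, (follow φ (dartVal d)).2))
    (Finite.injective_iff_bijective.1 fun a b hab => by
      have h₁ : follow φ (dartVal a) = follow φ (dartVal b) := by
        simpa [Prod.ext_iff] using hab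
      have h₂ := φ.injective h₁
      refine dartVal_injective ?_
      simpa [Prod.ext_iff] using h₂)

theorem dartVal_next (h : IsSurfaceMap P lab org φ reg Vs Es Fs p) (d : Es × Bool) :
    dartVal (h.next d) = follow φ (dartVal d) := rfl

end IsSurfaceMap

end PlaneMaps

/-! ### Nonnegativity of the genus, by linear algebra -/

section Genus

variable {V E R : Type}

/-- The coboundary of a function on the vertices. -/
def coboundary (org : E × Bool → V) : (V → ℚ) →ₗ[ℚ] (E → ℚ) :=
  LinearMap.funLeft ℚ ℚ (fun e => org (e, false)) - LinearMap.funLeft ℚ ℚ (fun e => org (e, true))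

/-- The boundary of a combination of regions. -/
def regionBoundary (reg : E × Bool → R) : (R → ℚ) →ₗ[ℚ] (E → ℚ) :=
  LinearMap.funLeft ℚ ℚ (fun e => reg (e, true)) - LinearMap.funLeft ℚ ℚ (fun e => reg (e, false))

theorem coboundary_apply (org : E × Bool → V) (h : V → ℚ) (e : E) :
    coboundary org h e = h (org (e, false)) - h (org (e, true)) := rfl

theorem regionBoundary_apply (reg : E × Bool → R) (g : R → ℚ) (e : E) :
    regionBoundary reg g e = g (reg (e, true)) - g (reg (e, false)) := rfl

/-- Summation by parts: the two orientations of an edge together contribute the changes of `h (org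
d) * g (reg d)` under the permutation `nx`, and these sum to zero. -/
theorem sum_coboundary_mul_regionBoundary [Fintype E] {org : E × Bool → V} {reg : E × Bool → R}
    (nx : Equiv.Perm (E × Bool)) (ho : ∀ d, org (nx d) = org (d.1, !d.2))
    (hr : ∀ d, reg (nx d) = reg d) (h : V → ℚ) (g : R → ℚ) :
    ∑ e, coboundary org h e * regionBoundary reg g e = 0 := by
  have h₁ : ∑ e, coboundary org h e * regionBoundary reg g e =
      ∑ d : E × Bool, (h (org (nx d)) * g (reg (nx d)) - h (org d) * g (reg d)) := by
    rw [Fintype.sum_prod_type]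
    refine Finset.sum_congr rfl fun e _ => ?_
    rw [Fintype.sum_bool, ho, ho, hr, hr, coboundary_apply, regionBoundary_apply, Bool.not_true,
      Bool.not_false]
    ring
  rw [h₁, Finset.sum_sub_distrib, Equiv.sum_comp nx fun d => h (org d) * g (reg d), sub_self]

theorem card_le_finrank_range_add_one {X : Type} [Fintype X] (T : (X → ℚ) →ₗ[ℚ] (E → ℚ))
    (hT : ∀ h, T h = 0 → ∀ x y, h x = h y) :
    Fintype.card X ≤ Module.finrank ℚ (LinearMap.range T) + 1 := by
  have h₁ := LinearMap.finrank_range_add_finrank_ker T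
  rw [Module.finrank_fintype_fun_eq_card] at h₁
  have h₂ : LinearMap.ker T ≤ Submodule.span ℚ {fun _ => 1} := by
    intro h hh
    rw [Submodule.mem_span_singleton]
    rcases isEmpty_or_nonempty X with _ | ⟨⟨x⟩⟩
    · exact ⟨0, Subsingleton.elim _ _⟩
    · exact ⟨h x, funext fun y => by simpa using hT h hh x y⟩
  have h₃ := Submodule.finrank_mono h₂
  have h₄ := finrank_span_le_card (R := ℚ) ({fun _ => 1} : Set (X → ℚ))
  simp only [Set.toFinset_singleton, Finset.card_singleton] at h₄
  omega

/-- The genus of a closed oriented connected surface is nonnegative; if it is zero, then an edge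
with the same region on both sides separates. -/
theorem card_add_card_le [Fintype V] [Fintype E] [Fintype R] {org : E × Bool → V}
    {reg : E × Bool → R}
    (nx : Equiv.Perm (E × Bool)) (ho : ∀ d, org (nx d) = org (d.1, !d.2))
    (hr : ∀ d, reg (nx d) = reg d)
    (hV : ∀ h, coboundary org h = 0 → ∀ x y, h x = h y)
    (hR : ∀ g, regionBoundary reg g = 0 → ∀ x y, g x = g y) :
    Fintype.card V + Fintype.card R ≤ Fintype.card E + 2 ∧
    (Fintype.card V + Fintype.card R = Fintype.card E + 2 →
      ∀ e, reg (e, true) = reg (e, false) → ∃ h, ∀ e', coboundary org h e' = 0 ↔ e' ≠ e) := by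
  classical
  have horth := sum_coboundary_mul_regionBoundary nx ho hr
  have hV' := card_le_finrank_range_add_one _ hV
  have hR' := card_le_finrank_range_add_one _ hR
  -- A vector in both ranges is orthogonal to itself, hence zero over `ℚ`.
  have hdisj : LinearMap.range (coboundary org) ⊓ LinearMap.range (regionBoundary reg) = ⊥ := by
    rw [eq_bot_iff]
    rintro _ ⟨⟨h, rfl⟩, ⟨g, hg⟩⟩
    have := horth h g
    rw [hg, Finset.sum_mul_self_eq_zero_iff] at this
    exact (Submodule.mem_bot ℚ).2 (funext fun e => this e (Finset.mem_univ e))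
  have hsum := Submodule.finrank_sup_add_finrank_inf_eq (LinearMap.range (coboundary org))
    (LinearMap.range (regionBoundary reg))
  rw [hdisj, finrank_bot, add_zero] at hsum
  have hle := Submodule.finrank_le
    (LinearMap.range (coboundary org) ⊔ LinearMap.range (regionBoundary reg))
  rw [Module.finrank_fintype_fun_eq_card] at hle
  refine ⟨by omega, fun heq e he => ?_⟩
  -- By equality of dimensions the two ranges span. The indicator of an edge with one region on both
  -- sides is orthogonal to all region boundaries, so its component there vanishes. It is thus the
  -- coboundary of a function that changes across this edge only.
  have htop : LinearMap.range (coboundary org) ⊔ LinearMap.range (regionBoundary reg) = ⊤ := by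
    apply Submodule.eq_top_of_finrank_eq
    rw [Module.finrank_fintype_fun_eq_card]
    omega
  have hmem : Pi.single e (1 : ℚ) ∈
      LinearMap.range (coboundary org) ⊔ LinearMap.range (regionBoundary reg) := by
    rw [htop]; trivial
  obtain ⟨_, ⟨h, rfl⟩, _, ⟨g, rfl⟩, hg⟩ := Submodule.mem_sup.1 hmem
  have hg0 : regionBoundary reg g = 0 := by
    have h₁ : ∑ e', (Pi.single e (1 : ℚ) : E → ℚ) e' * regionBoundary reg g e' = 0 := by
      simp [Pi.single_apply, regionBoundary_apply, he]
    simp only [← hg, Pi.add_apply, add_mul, Finset.sum_add_distrib, horth, zero_add] at h₁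
    rw [Finset.sum_mul_self_eq_zero_iff] at h₁
    exact funext fun e => h₁ e (Finset.mem_univ e)
  rw [hg0, add_zero] at hg
  refine ⟨h, fun e' => ?_⟩
  rw [hg]
  by_cases hee : e' = e
  · subst hee; simp
  · simp [hee]

end Genus

namespace IsSurfaceMap

variable {A : Type*} {V E F : Type} {P : Presentation A} {lab : E → A} {org : E × Bool → V}
  {φ : Equiv.Perm (E × Bool)} {reg : E × Bool → Option F} {Vs : Finset V} {Es : Finset E}
  {Fs : Finset F} {p : List (E × Bool)}

/-- The initial vertex, within the set of the vertices of the map. -/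
def origin (h : IsSurfaceMap P lab org φ reg Vs Es Fs p) (d : Es × Bool) : Vs :=
  ⟨org (dartVal d), h.org_mem _ d.1.2⟩

/-- The region, within the set of the faces of the map. -/
def region (h : IsSurfaceMap P lab org φ reg Vs Es Fs p) (d : Es × Bool) : Option Fs :=
  match hr : reg (dartVal d) with
  | none => none
  | some f => some ⟨f, h.reg_mem _ d.1.2 f hr⟩

theorem map_region (h : IsSurfaceMap P lab org φ reg Vs Es Fs p) (d : Es × Bool) :
    (h.region d).map Subtype.val = reg (dartVal d) := by
  unfold region
  split <;> simp_all

theorem region_inj (h : IsSurfaceMap P lab org φ reg Vs Es Fs p) {d d' : Es × Bool} :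
    h.region d = h.region d' ↔ reg (dartVal d) = reg (dartVal d') := by
  rw [← h.map_region, ← h.map_region]
  exact (Option.map_injective Subtype.val_injective).eq_iff.symm

theorem exists_region (h : IsSurfaceMap P lab org φ reg Vs Es Fs p) (hE : Es.Nonempty)
    (r : Option Fs) : ∃ d, h.region d = r := by
  obtain ⟨d, hd, hdr⟩ : ∃ d : E × Bool, d.1 ∈ Es ∧ reg d = r.map Subtype.val := by
    rcases r with _ | ⟨f, hf⟩
    · obtain ⟨d, l, rfl⟩ := List.exists_cons_of_ne_nil (h.outer_ne hE)
      exact ⟨d, (h.outer.mem_iff d).1 (by simp)⟩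
    · exact h.exists_dart hf
  refine ⟨(⟨d.1, hd⟩, d.2), Option.map_injective Subtype.val_injective ?_⟩
  rw [h.map_region]
  exact hdr

/-- The outer region is one more region besides `Fs`, which turns `+ 2` into `+ 1`. The set `S` is a
level set of the vertex function that changes only across the edge of `d`. -/
theorem card_add_card_le (h : IsSurfaceMap P lab org φ reg Vs Es Fs p) :
    Vs.card + Fs.card ≤ Es.card + 1 ∧
    (Vs.card + Fs.card = Es.card + 1 → ∀ d, d.1 ∈ Es → reg d = reg (d.1, !d.2) →
      ∃ S : V → Prop, S (org (d.1, !d.2)) ∧ ¬ S (org d) ∧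
        ∀ y, y.1 ∈ Es → y.1 ≠ d.1 → (S (org y) ↔ S (org (y.1, !y.2)))) := by
  have key := DehnPres.card_add_card_le (org := h.origin) (reg := h.region) h.next
    (fun d => Subtype.ext (h.org_follow d.1.2))
    (fun d => h.region_inj.2 (h.reg_follow d.1.2))
    (fun g hg x y => by
      refine (h.connected (fun v => ∀ hv, g ⟨v, hv⟩ = g x) ?_ x x.2 y y.2 (fun _ => rfl) y.2).symm
      intro d hd
      have h₁ := congrFun hg ⟨d.1, hd⟩
      rw [coboundary_apply, Pi.zero_apply, sub_eq_zero] at h₁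
      have h₂ : g (h.origin (⟨d.1, hd⟩, d.2)) = g (h.origin (⟨d.1, hd⟩, !d.2)) := by
        rcases d with ⟨e, _ | _⟩
        exacts [h₁, h₁.symm]
      refine ⟨fun k hv => ?_, fun k hv => ?_⟩
      · exact h₂.symm.trans (k (h.org_mem _ hd))
      · exact h₂.trans (k (h.org_mem (d.1, !d.2) hd)))
    (fun g hg => by
      have hg' : ∀ d, g (h.region (d.1, !d.2)) = g (h.region d) := by
        rintro ⟨e, b⟩
        have := congrFun hg e
        rw [regionBoundary_apply, Pi.zero_apply, sub_eq_zero] at this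
        rcases b with _ | _
        exacts [this, this.symm]
      -- Consecutive edges around a vertex share a region, and `g` agrees on the two sides of each
      -- edge; so `g` is constant around the vertex. Connectedness then spreads this over the whole
      -- map.
      have hv : ∀ d d' : Es × Bool, org (dartVal d) = org (dartVal d') →
          g (h.region d) = g (h.region d') := by
        intro d d' hd
        have := (sameCycle_mem_iff (φ := φ) (Q := fun y => ∀ hy : y.1 ∈ Es,
          g (h.region (⟨y.1, hy⟩, y.2)) = g (h.region d)) ?_
          (h.sameCycle _ _ d.1.2 d'.1.2 hd)).1 (fun _ => rfl)
        · exact (this d'.1.2).symm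
        · intro y
          by_cases hy : y.1 ∈ Es
          · have h₁ : h.region (⟨(φ y).1, (h.mem_iff y).2 hy⟩, (φ y).2) =
                h.region (⟨y.1, hy⟩, !y.2) := by
              rw [h.region_inj]
              have := h.reg_follow (d := (y.1, !y.2)) hy
              simpa [follow, dartVal] using this
            have h₂ := hg' (⟨y.1, hy⟩, y.2)
            rw [← h₁] at h₂
            exact ⟨fun k hy' => h₂.symm.trans (k _), fun k hy' => h₂.trans (k _)⟩
          · have hy' := mt (h.mem_iff y).1 hy
            exact ⟨fun _ k => (hy k).elim, fun _ k => (hy' k).elim⟩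
      have hdd : ∀ d d', g (h.region d) = g (h.region d') := by
        have hstep : ∀ (x : Es × Bool) (d : E × Bool), d.1 ∈ Es →
            (∀ d' : Es × Bool, org (dartVal d') = org d → g (h.region d') = g (h.region x)) →
            ∀ d' : Es × Bool, org (dartVal d') = org (d.1, !d.2) →
              g (h.region d') = g (h.region x) := by
          intro x d hd k d' hd'
          rw [hv d' (⟨d.1, hd⟩, !d.2) hd', hg' (⟨d.1, hd⟩, d.2)]
          exact k _ rfl
        intro x y
        refine (h.connected (fun v => ∀ d : Es × Bool, org (dartVal d) = v →
          g (h.region d) = g (h.region x)) ?_ _ (h.origin x).2 _ (h.origin y).2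
          (fun d hd => hv _ _ hd) y rfl).symm
        intro d hd
        refine ⟨hstep x d hd, fun k => ?_⟩
        have := hstep x (d.1, !d.2) hd k
        simpa using this
      rcases Es.eq_empty_or_nonempty with hE | hE
      · have : Fs = ∅ := by
          by_contra hF
          obtain ⟨f, hf⟩ := Finset.nonempty_iff_ne_empty.2 hF
          obtain ⟨d, hd, -⟩ := h.exists_dart hf
          simp [hE] at hd
        subst this
        intro x y
        rw [Subsingleton.elim x y]
      · intro x y
        obtain ⟨x, rfl⟩ := h.exists_region hE x
        obtain ⟨y, rfl⟩ := h.exists_region hE y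
        exact hdd x y)
  simp only [Fintype.card_coe, Fintype.card_option] at key
  refine ⟨by omega, fun heq d hd hr => ?_⟩
  obtain ⟨c, hc⟩ := key.2 (by omega) ⟨d.1, hd⟩ (by
    rw [h.region_inj]
    rcases d with ⟨e, _ | _⟩
    exacts [hr.symm, hr])
  have hc' : ∀ (y : E × Bool) (hy : y.1 ∈ Es),
      c (h.origin (⟨y.1, hy⟩, !y.2)) = c (h.origin (⟨y.1, hy⟩, y.2)) ↔ y.1 ≠ d.1 := by
    intro y hy
    have := hc ⟨y.1, hy⟩
    rw [coboundary_apply, sub_eq_zero, Ne, Subtype.mk.injEq] at this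
    rcases y with ⟨e, _ | _⟩
    exacts [eq_comm.trans this, this]
  refine ⟨fun v => ∃ hv, c ⟨v, hv⟩ = c (h.origin (⟨d.1, hd⟩, !d.2)), ⟨h.org_mem (d.1, !d.2) hd, rfl⟩,
    ?_, ?_⟩
  · rintro ⟨_, k⟩
    exact (hc' d hd).1 k.symm rfl
  · intro y hy hyd
    have := (hc' y hy).2 hyd
    refine ⟨fun ⟨_, k⟩ => ⟨h.org_mem (y.1, !y.2) hy, this.trans k⟩,
      fun ⟨_, k⟩ => ⟨h.org_mem y hy, this.symm.trans k⟩⟩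

end IsSurfaceMap

/-! ### Boundary walks when an edge is left out -/

section Rerouting

variable {D : Type*} {σ σ' : D → D} {d r : D}

/-- Since the targets other than the last form `l`, only the last step of the chain is redirected.
-/
theorem map_retarget {L l : List D} {b b' : D} (h : L.map σ = l ++ [b])
    (h₁ : ∀ y ∈ L, σ y ∈ l → σ' y = σ y) (h₂ : ∀ y ∈ L, σ y = b → σ' y = b') :
    L.map σ' = l ++ [b'] := by
  rcases List.eq_nil_or_concat' L with rfl | ⟨L, y, rfl⟩
  · simp at h
  · rw [List.map_append, List.map_singleton] at h
    obtain ⟨h, hy⟩ := List.append_inj' h rfl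
    subst h
    rw [List.map_append, List.map_singleton, h₂ y (by simp) (by simpa using hy)]
    congr 1
    exact List.map_congr_left fun z hz => h₁ z (by simp [hz]) (List.mem_map_of_mem hz)

theorem map_retarget_of_notMem {a c b b' : D} {l : List D}
    (h : σ a :: (c :: l).map σ = c :: l ++ [b]) (hd : d ∉ c :: l) (hr : r ∉ c :: l)
    (h₁ : ∀ y, y ≠ d → y ≠ r → σ y ≠ d → σ y ≠ r → σ' y = σ y)
    (h₂ : ∀ y, y ≠ d → y ≠ r → σ y = b → σ' y = b') :
    σ a = c ∧ (c :: l).map σ' = l ++ [b'] := by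
  rw [List.cons_append, List.cons.injEq] at h
  refine ⟨h.1, map_retarget h.2 (fun y hy hl => ?_) fun y hy => ?_⟩
  · apply h₁ y (ne_of_mem_of_not_mem hy hd) (ne_of_mem_of_not_mem hy hr)
    · exact ne_of_mem_of_not_mem (List.mem_cons_of_mem _ hl) hd
    · exact ne_of_mem_of_not_mem (List.mem_cons_of_mem _ hl) hr
  · exact h₂ y (ne_of_mem_of_not_mem hy hd) (ne_of_mem_of_not_mem hy hr)

variable [DecidableEq D]

/-- The walks of `σ'` are those of `σ` when the two orientations `d` and `r` of an edge are left
out. -/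
def IsRerouting (σ σ' : D → D) (d r : D) : Prop :=
  ∀ y, y ≠ d → y ≠ r → σ' y = if (if σ y = d then σ r else σ y) = r
    then (if σ d = d then σ r else σ d) else (if σ y = d then σ r else σ y)

theorem IsRerouting.eq (h : IsRerouting σ σ' d r) (y : D) (h₁ : y ≠ d) (h₂ : y ≠ r)
    (h₃ : σ y ≠ d) (h₄ : σ y ≠ r) : σ' y = σ y := by
  rw [h y h₁ h₂]; simp [h₃, h₄]

/-- The edge lies between two regions. The last step of `p`, which led to `d`, now leads to the
start of `u`, and the last step of `u` to the start of `p`. An empty list makes the other walk close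
up on itself. -/
theorem IsRerouting.merge (h : IsRerouting σ σ' d r) (hdr : d ≠ r) {p u : List D}
    (hp : σ d :: p.map σ = p ++ [d]) (hu : σ r :: u.map σ = u ++ [r])
    (h₁ : d ∉ p) (h₂ : r ∉ p) (h₃ : d ∉ u) (h₄ : r ∉ u) :
    (u ++ p).map σ' = (u ++ p).rotate 1 := by
  rcases p with _ | ⟨c, p⟩ <;> rcases u with _ | ⟨b, u⟩
  · rfl
  · have hd : σ d = d := by simpa using hp
    have hb : σ r = b := by simpa using congrArg List.head? hu
    have := map_retarget_of_notMem (b' := b) hu h₃ h₄ h.eq (by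
      intro y k₁ k₂ k₃
      rw [h y k₁ k₂]; simp [k₃, hdr.symm, hd, hb])
    simpa using this.2
  · have hr : σ r = r := by simpa using hu
    have hc : σ d = c := by simpa using congrArg List.head? hp
    have hcd : c ≠ d := by rintro rfl; simp at h₁
    have := map_retarget_of_notMem (b' := c) hp h₁ h₂ h.eq (by
      intro y k₁ k₂ k₃
      rw [h y k₁ k₂]; simp [k₃, hr, hc, hcd])
    simpa using this.2
  · have hb : σ r = b := by simpa using congrArg List.head? hu
    have hc : σ d = c := by simpa using congrArg List.head? hp
    have hcd : c ≠ d := by rintro rfl; simp at h₁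
    have hbr : b ≠ r := by rintro rfl; simp at h₄
    have k₁ := map_retarget_of_notMem (b' := b) hp h₁ h₂ h.eq (by
      intro y k₁ k₂ k₃
      rw [h y k₁ k₂]; simp [k₃, hb, hbr])
    have k₂ := map_retarget_of_notMem (b' := c) hu h₃ h₄ h.eq (by
      intro y k₁ k₂ k₃
      rw [h y k₁ k₂]; simp [k₃, hc, hcd, hdr.symm])
    rw [List.map_append, k₁.2, k₂.2]
    simp

/-- Both orientations lie on one walk `d p r q`. The step from the end of `p` to `r` is redirected
to the start of `p`, which closes up `p`. -/
theorem IsRerouting.split (h : IsRerouting σ σ' d r) (hdr : d ≠ r) {p q : List D}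
    (hp : σ d :: (p ++ r :: q).map σ = p ++ r :: q ++ [d])
    (h₁ : d ∉ p) (h₂ : r ∉ p) : p.map σ' = p.rotate 1 := by
  rcases p with _ | ⟨c, p⟩
  · rfl
  · have hc : σ d = c := by simpa using congrArg List.head? hp
    have hcd : c ≠ d := by rintro rfl; simp at h₁
    have hp' : σ d :: (c :: p).map σ = c :: p ++ [r] := by
      have : (σ d :: (c :: p).map σ) ++ (r :: q).map σ = (c :: p ++ [r]) ++ (q ++ [d]) := by
        simpa using hp
      exact (List.append_inj this (by simp)).1
    have k₁ := map_retarget_of_notMem (b' := c) hp' h₁ h₂ h.eq (by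
      intro y k₁ k₂ k₃
      rw [h y k₁ k₂]; simp [k₃, hc, hcd, hdr.symm])
    simpa using k₁.2

end Rerouting

variable {A : Type*} {V E F : Type}

theorem IsWalk.congr {D : Type*} {σ σ' : D → D} {s s' : D → Prop} {p : List D}
    (h : IsWalk σ s p) (hσ : ∀ d, s d → σ' d = σ d) (hs : ∀ d, s' d ↔ s d) : IsWalk σ' s' p :=
  ⟨h.nodup, fun d => (h.mem_iff d).trans (hs d).symm, by
    rw [← h.map_eq]
    exact List.map_congr_left fun d hd => hσ d ((h.mem_iff d).1 hd)⟩

theorem Presentation.IsFaceLabel.of_isRotated {P : Presentation A} {w w' : Word A}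
    (h : P.IsFaceLabel w) (hw : w.IsRotated w') : P.IsFaceLabel w' := by
  obtain ⟨r, hr, h⟩ := h
  exact ⟨r, hr.trans hw, h⟩

theorem pathWord_isRotated (lab : E → A) {p q : List (E × Bool)} (h : p.IsRotated q) :
    (pathWord lab p).IsRotated (pathWord lab q) := h.map _

theorem eq_or_eq_of_fst_eq {d y : E × Bool} (h : y.1 = d.1) : y = d ∨ y = (d.1, !d.2) := by
  rcases d with ⟨e, b⟩
  rcases y with ⟨e', b'⟩
  obtain rfl : e' = e := h
  cases b <;> cases b' <;> simp

theorem ne_reversal (d : E × Bool) : d ≠ (d.1, !d.2) := by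
  rcases d with ⟨e, b⟩
  simp

/-! ### Deleting a boundary edge in front of a face -/

section Deletion

variable [DecidableEq E]

/-- The cyclic orders around the vertices after the deletion of the edge of `d`. -/
def deleteEdge (d : E × Bool) (φ : Equiv.Perm (E × Bool)) : Equiv.Perm (E × Bool) :=
  skip (d.1, !d.2) (skip d φ)

theorem deleteEdge_isRerouting (d : E × Bool) (φ : Equiv.Perm (E × Bool)) :
    IsRerouting (follow φ) (follow (deleteEdge d φ)) d (d.1, !d.2) := by
  intro y h₁ h₂
  have h₃ : (y.1, !y.2) ≠ (d.1, !d.2) := by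
    rcases y with ⟨e, b⟩; rcases d with ⟨e', b'⟩
    simpa using h₁
  have h₄ : (y.1, !y.2) ≠ d := by
    rcases y with ⟨e, b⟩; rcases d with ⟨e', b'⟩
    cases b <;> cases b' <;> simp_all
  have h₅ := (ne_reversal d).symm
  simp only [follow, deleteEdge, skip_apply, if_neg h₃, if_neg h₄, if_neg h₅, Bool.not_not]

theorem deleteEdge_fst (d : E × Bool) (φ : Equiv.Perm (E × Bool)) (y : E × Bool) :
    (deleteEdge d φ y).1 = d.1 ↔ y.1 = d.1 := by
  have h₁ : deleteEdge d φ d = d := by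
    simp [deleteEdge, skip_apply, ne_reversal d]
  have h₂ : deleteEdge d φ (d.1, !d.2) = (d.1, !d.2) := by
    rw [deleteEdge, skip_apply, if_pos rfl]
  constructor
  · intro h
    rcases eq_or_eq_of_fst_eq h with h | h
    · rw [(deleteEdge d φ).injective (h.trans h₁.symm)]
    · rw [(deleteEdge d φ).injective (h.trans h₂.symm)]
  · intro h
    rcases eq_or_eq_of_fst_eq h with rfl | rfl
    · rw [h₁]
    · rw [h₂]

theorem deleteEdge_sameCycle {d : E × Bool} {φ : Equiv.Perm (E × Bool)} {y z : E × Bool}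
    (hy : y.1 ≠ d.1) (hz : z.1 ≠ d.1) (h : φ.SameCycle y z) :
    (deleteEdge d φ).SameCycle y z := by
  apply skip_sameCycle (fun k => hy (by rw [k])) (fun k => hz (by rw [k]))
  exact skip_sameCycle (fun k => hy (by rw [k])) (fun k => hz (by rw [k])) h

namespace IsSurfaceMap

variable [DecidableEq F] {P : Presentation A} {lab : E → A} {org : E × Bool → V}
  {φ : Equiv.Perm (E × Bool)} {reg : E × Bool → Option F} {Vs : Finset V} {Es : Finset E}
  {Fs : Finset F} {p : List (E × Bool)}

omit [DecidableEq E] [DecidableEq F] in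
theorem rotate (h : IsSurfaceMap P lab org φ reg Vs Es Fs p) {q : List (E × Bool)}
    (hq : p.IsRotated q) : IsSurfaceMap P lab org φ reg Vs Es Fs q :=
  { h with
    outer := h.outer.of_isRotated hq
    outer_ne := fun hE hq' => h.outer_ne hE (by
      subst hq'
      exact List.isRotated_nil_iff.1 hq) }

omit [DecidableEq F] in
theorem org_deleteEdge (h : IsSurfaceMap P lab org φ reg Vs Es Fs p) {d : E × Bool}
    (hd : d.1 ∈ Es) {y : E × Bool} (hy : y.1 ∈ Es) : org (deleteEdge d φ y) = org y := by
  have key : ∀ (x : E × Bool) (ψ : Equiv.Perm (E × Bool)), x.1 ∈ Es →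
      (∀ y, y.1 ∈ Es → org (ψ y) = org y) → ∀ y, y.1 ∈ Es → org (skip x ψ y) = org y := by
    intro x ψ hx hψ y hy
    rw [skip_apply]
    split_ifs with h₁ h₂
    · rw [h₁]
    · rw [hψ x hx, ← h₂, hψ y hy]
    · exact hψ y hy
  exact key (d.1, !d.2) _ hd (key d φ hd h.org_eq) y hy

omit [DecidableEq F] in
theorem deleteEdge_mem_iff (h : IsSurfaceMap P lab org φ reg Vs Es Fs p) {d : E × Bool}
    (hd : d.1 ∈ Es) (y : E × Bool) : (deleteEdge d φ y).1 ∈ Es.erase d.1 ↔ y.1 ∈ Es.erase d.1 := by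
  have key : ∀ (x : E × Bool) (ψ : Equiv.Perm (E × Bool)), x.1 ∈ Es →
      (∀ y, (ψ y).1 ∈ Es ↔ y.1 ∈ Es) → ∀ y, (skip x ψ y).1 ∈ Es ↔ y.1 ∈ Es := by
    intro x ψ hx hψ y
    rw [skip_apply]
    split_ifs with h₁ h₂
    · rw [h₁]
    · rw [hψ x, ← hψ y, h₂]
    · exact hψ y
  rw [Finset.mem_erase, Finset.mem_erase, Ne, Ne, deleteEdge_fst, deleteEdge,
    key (d.1, !d.2) _ hd (key d φ hd h.mem_iff)]

omit [DecidableEq F] in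
theorem follow_deleteEdge (h : IsSurfaceMap P lab org φ reg Vs Es Fs p) {d : E × Bool}
    {f : F} (hf : reg d ≠ some f) (hf' : reg (d.1, !d.2) ≠ some f) {y : E × Bool} (hy : y.1 ∈ Es)
    (hyf : reg y = some f) : follow (deleteEdge d φ) y = follow φ y := by
  have hne : ∀ z, reg z = some f → z ≠ d ∧ z ≠ (d.1, !d.2) := fun z hz =>
    ⟨fun k => hf (by rw [← k, hz]), fun k => hf' (by rw [← k, hz])⟩
  have h₁ := hne y hyf
  have h₂ := hne (follow φ y) ((h.reg_follow hy).trans hyf)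
  exact (deleteEdge_isRerouting d φ).eq y h₁.1 h₁.2 h₂.1 h₂.2

omit [DecidableEq E] [DecidableEq F] in
theorem fst_ne_of_reg_eq_some {d : E × Bool} {f : F} (hf : reg d ≠ some f)
    (hf' : reg (d.1, !d.2) ≠ some f) {y : E × Bool} (hy : reg y = some f) : y.1 ≠ d.1 := by
  intro k
  rcases eq_or_eq_of_fst_eq k with rfl | rfl
  exacts [hf hy, hf' hy]

/-- The face is opened to the outer region, and the rest `u` of its boundary replaces `d` on the
outer walk. -/
theorem delete_face (h : IsSurfaceMap P lab org φ reg Vs Es Fs p) {d : E × Bool}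
    {p' : List (E × Bool)} (hp : p = d :: p') {f : F} (hf : reg (d.1, !d.2) = some f) :
    ∃ u, P.IsFaceLabel (pathWord lab ((d.1, !d.2) :: u)) ∧
      IsSurfaceMap P lab org (deleteEdge d φ) (fun y => if reg y = some f then none else reg y) Vs
        (Es.erase d.1) (Fs.erase f) (u ++ p') := by
  subst hp
  obtain ⟨hd, hdn⟩ := (h.outer.mem_iff d).1 (by simp)
  obtain ⟨q, hq, hl⟩ := h.faces f (h.reg_mem (d.1, !d.2) hd f hf)
  obtain ⟨u, hqu, hu⟩ := hq.exists_cons (d := (d.1, !d.2)) ⟨hd, hf⟩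
  have hdp : d ∉ p' := (List.nodup_cons.1 h.outer.nodup).1
  have hrp : (d.1, !d.2) ∉ p' := fun k => by
    have := ((h.outer.mem_iff _).1 (List.mem_cons_of_mem _ k)).2
    rw [hf] at this; simp at this
  have hru : (d.1, !d.2) ∉ u := (List.nodup_cons.1 hu.nodup).1
  have hdu : d ∉ u := fun k => by
    have := ((hu.mem_iff _).1 (List.mem_cons_of_mem _ k)).2
    rw [hdn] at this; simp at this
  refine ⟨u, hl.of_isRotated (pathWord_isRotated lab hqu), ?_⟩
  constructor
  · exact fun y hy => h.org_mem y (Finset.mem_of_mem_erase hy)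
  · intro y hy g hg
    by_cases hyf : reg y = some f
    · simp [hyf] at hg
    · rw [if_neg hyf] at hg
      refine Finset.mem_erase.2 ⟨?_, h.reg_mem y (Finset.mem_of_mem_erase hy) g hg⟩
      rintro rfl
      exact hyf hg
  · exact h.deleteEdge_mem_iff hd
  · exact fun y hy => h.org_deleteEdge hd (Finset.mem_of_mem_erase hy)
  · intro y z hy hz hyz
    exact deleteEdge_sameCycle (Finset.ne_of_mem_erase hy) (Finset.ne_of_mem_erase hz)
      (h.sameCycle y z (Finset.mem_of_mem_erase hy) (Finset.mem_of_mem_erase hz) hyz)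
  · refine ⟨?_, ?_, ?_⟩
    · refine List.Nodup.append (List.nodup_cons.1 hu.nodup).2 (List.nodup_cons.1 h.outer.nodup).2 ?_
      intro y hyu hyp
      have h₁ := ((hu.mem_iff y).1 (List.mem_cons_of_mem _ hyu)).2
      have h₂ := ((h.outer.mem_iff y).1 (List.mem_cons_of_mem _ hyp)).2
      rw [h₁] at h₂; simp at h₂
    · intro y
      have h₁ := hu.mem_iff y
      have h₂ := h.outer.mem_iff y
      rw [List.mem_cons] at h₁ h₂
      rw [List.mem_append, Finset.mem_erase]
      by_cases hy : y.1 = d.1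
      · rcases eq_or_eq_of_fst_eq hy with rfl | rfl
        · simp [hdu, hdp]
        · simp [hru, hrp]
      · have h₃ : y ≠ d := fun k => hy (by rw [k])
        have h₄ : y ≠ (d.1, !d.2) := fun k => hy (by rw [k])
        simp only [h₃, h₄, false_or] at h₁ h₂
        rw [h₁, h₂]
        split_ifs with h₅ <;> simp [h₅, hy]
    · exact (deleteEdge_isRerouting d φ).merge (ne_reversal d) h.outer.cons_map_eq hu.cons_map_eq
        hdp hrp hdu hru
  · intro g hg
    obtain ⟨hgf, hg⟩ := Finset.mem_erase.1 hg
    obtain ⟨q, hq, hl⟩ := h.faces g hg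
    have h₁ : reg d ≠ some g := by rw [hdn]; simp
    have h₂ : reg (d.1, !d.2) ≠ some g := by rw [hf]; simpa using Ne.symm hgf
    refine ⟨q, hq.congr (fun y hy => h.follow_deleteEdge h₁ h₂ hy.1 hy.2) fun y => ?_, hl⟩
    rw [Finset.mem_erase]
    constructor
    · rintro ⟨⟨-, k₁⟩, k₂⟩
      split_ifs at k₂
      exact ⟨k₁, k₂⟩
    · rintro ⟨k₁, k₂⟩
      refine ⟨⟨fst_ne_of_reg_eq_some h₁ h₂ k₂, k₁⟩, ?_⟩
      rw [k₂, if_neg (by simpa using hgf)]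
  -- If nothing is left of either walk, `d` is a loop at a vertex with no other edge, so by
  -- connectedness there was no other edge at all.
  · rintro ⟨e, he⟩ hnil
    obtain ⟨rfl, rfl⟩ := List.append_eq_nil_iff.1 hnil
    obtain ⟨hed, he⟩ := Finset.mem_erase.1 he
    have h₁ : φ (d.1, !d.2) = d := by simpa [follow] using h.outer.cons_map_eq
    have h₂ : φ d = (d.1, !d.2) := by simpa [follow] using hu.cons_map_eq
    have horb : ∀ y : E × Bool, y.1 ∈ Es → org y = org d → y.1 = d.1 := by
      intro y hy hyd
      refine (sameCycle_mem_iff (Q := fun y => y.1 = d.1) (fun y => ?_)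
        (h.sameCycle d y hd hy hyd.symm)).1 rfl
      constructor
      · intro k
        rcases eq_or_eq_of_fst_eq k with k | k
        · rw [φ.injective (k.trans h₁.symm)]
        · rw [φ.injective (k.trans h₂.symm)]
      · intro k
        rcases eq_or_eq_of_fst_eq k with rfl | rfl
        · rw [h₂]
        · rw [h₁]
    have hod : org (d.1, !d.2) = org d := by
      rw [← h.org_eq (d.1, !d.2) hd, h₁]
    refine hed (horb (e, true) he (h.connected (· = org d) ?_ _ (h.org_mem d hd) _
      (h.org_mem (e, true) he) rfl))
    have hstep : ∀ y : E × Bool, y.1 ∈ Es → org y = org d → org (y.1, !y.2) = org d := by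
      intro y hy hyd
      rcases eq_or_eq_of_fst_eq (horb y hy hyd) with rfl | rfl
      · exact hod
      · simp
    intro y hy
    exact ⟨hstep y hy, fun k => by simpa using hstep (y.1, !y.2) hy k⟩
  · exact h.nonempty
  · intro S hS
    refine h.connected S fun y hy => ?_
    -- The path `u` still joins the two ends of the deleted edge.
    have hS' : S (org d) ↔ S (org (d.1, !d.2)) := by
      refine (chain_forall (Q := fun y => S (org d) ↔ S (org y)) hu.cons_map_eq ?_ ?_).2
      · have := h.org_follow (d := (d.1, !d.2)) hd
        rw [this]; simp
      · intro y hy hyS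
        have hyE := ((hu.mem_iff y).1 (List.mem_cons_of_mem _ hy)).1
        rw [h.org_follow hyE, hyS]
        refine hS y (Finset.mem_erase.2 ⟨fun k => ?_, hyE⟩)
        rcases eq_or_eq_of_fst_eq k with rfl | rfl
        exacts [hdu hy, hru hy]
    by_cases hyd : y.1 = d.1
    · rcases eq_or_eq_of_fst_eq hyd with rfl | rfl
      · exact hS'
      · simpa using hS'.symm
    · exact hS y (Finset.mem_erase.2 ⟨hyd, hy⟩)

end IsSurfaceMap

end Deletion

variable {A : Type*} {V E F : Type}

/-! ### Cutting at a bridge, and decomposition of spherical maps into discs -/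

namespace IsSurfaceMap

variable {P : Presentation A} {lab : E → A} {org : E × Bool → V}
  {φ : Equiv.Perm (E × Bool)} {reg : E × Bool → Option F} {Vs : Finset V} {Es : Finset E}
  {Fs : Finset F} {p : List (E × Bool)}

-- This keeps the side of the separating edge on which `d` ends; the other side comes from the
-- reverse of `d` and the complement of `S`. The boundary of a face avoids the edge of `d`, so it
-- stays on one side.
open Classical in
theorem delete_bridge (h : IsSurfaceMap P lab org φ reg Vs Es Fs p) {d : E × Bool}
    {p₁ p₂ : List (E × Bool)} (hp : p = d :: (p₁ ++ (d.1, !d.2) :: p₂)) {S : V → Prop}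
    (hSr : S (org (d.1, !d.2))) (hSd : ¬ S (org d))
    (hS : ∀ y, y.1 ∈ Es → y.1 ≠ d.1 → (S (org y) ↔ S (org (y.1, !y.2)))) :
    IsSurfaceMap P lab org (deleteEdge d φ) reg (Vs.filter S)
      ((Es.erase d.1).filter fun e => S (org (e, true)))
      (Fs.filter fun f => ∃ y, y.1 ∈ Es ∧ reg y = some f ∧ S (org y)) p₁ := by
  subst hp
  obtain ⟨hd, hdn⟩ := (h.outer.mem_iff d).1 (by simp)
  have hrn := ((h.outer.mem_iff (d.1, !d.2)).1 (by simp)).2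
  have hnod := h.outer.nodup
  simp only [List.nodup_cons, List.nodup_append, List.mem_append, List.mem_cons] at hnod
  have hdp : d ∉ p₁ := fun k => hnod.1 (.inl k)
  have hdp' : d ∉ p₂ := fun k => hnod.1 (.inr (.inr k))
  have hrp' : (d.1, !d.2) ∉ p₂ := hnod.2.2.1.1
  have hrp : (d.1, !d.2) ∉ p₁ := fun k => hnod.2.2.2 _ k _ (.inl rfl) rfl
  have hmem : ∀ y : E × Bool, y.1 ∈ (Es.erase d.1).filter (fun e => S (org (e, true))) ↔
      y.1 ∈ Es ∧ y.1 ≠ d.1 ∧ S (org y) := by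
    intro y
    rw [Finset.mem_filter, Finset.mem_erase, and_comm (a := y.1 ≠ d.1), and_assoc]
    refine and_congr_right fun h₁ => and_congr_right fun h₂ => ?_
    rcases y with ⟨e, _ | _⟩
    · exact hS (e, true) h₁ h₂
    · rfl
  have hsome : ∀ y : E × Bool, y.1 = d.1 → reg y = none := by
    intro y hy
    rcases eq_or_eq_of_fst_eq hy with rfl | rfl
    exacts [hdn, hrn]
  have hstep : ∀ y : E × Bool, y.1 ∈ Es → y.1 ≠ d.1 → (S (org (follow φ y)) ↔ S (org y)) := by
    intro y hy hyd
    rw [h.org_follow hy, hS y hy hyd]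
  have hout : ∀ y, y ∈ p₁ ∨ y = (d.1, !d.2) ∨ y ∈ p₂ → y.1 ∈ Es := fun y hy =>
    ((h.outer.mem_iff y).1 (by simp [hy])).1
  have hne : ∀ (y : E × Bool) (q : List (E × Bool)), y ∈ q → d ∉ q → (d.1, !d.2) ∉ q →
      y.1 ≠ d.1 := by
    intro y q hy h₁ h₂ k
    rcases eq_or_eq_of_fst_eq k with rfl | rfl
    exacts [h₁ hy, h₂ hy]
  have hchain : follow φ d :: p₁.map (follow φ) = p₁ ++ [(d.1, !d.2)] ∧
      follow φ (d.1, !d.2) :: p₂.map (follow φ) = p₂ ++ [d] := by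
    have : (follow φ d :: p₁.map (follow φ)) ++ (follow φ (d.1, !d.2) :: p₂.map (follow φ)) =
        (p₁ ++ [(d.1, !d.2)]) ++ (p₂ ++ [d]) := by
      simpa using h.outer.cons_map_eq
    exact List.append_inj this (by simp)
  have hp₁ : ∀ y ∈ p₁, S (org y) := by
    refine (chain_forall hchain.1 ?_ fun y hy hyS => ?_).1
    · rwa [h.org_follow hd]
    · exact (hstep y (hout y (.inl hy)) (hne y _ hy hdp hrp)).2 hyS
  have hp₂ : ∀ y ∈ p₂, ¬ S (org y) := by
    refine (chain_forall (Q := fun y => ¬ S (org y)) hchain.2 ?_ fun y hy hyS => ?_).1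
    · rw [h.org_follow (d := (d.1, !d.2)) hd]
      simpa using hSd
    · exact fun k => hyS ((hstep y (hout y (.inr (.inr hy))) (hne y _ hy hdp' hrp')).1 k)
  have hconn : ∀ T : V → Prop, (∀ y : E × Bool,
      y.1 ∈ (Es.erase d.1).filter (fun e => S (org (e, true))) →
        (T (org y) ↔ T (org (y.1, !y.2)))) →
      ∀ u ∈ Vs.filter S, ∀ v ∈ Vs.filter S, T u → T v := by
    intro T hT u hu v hv hTu
    obtain ⟨hu, hSu⟩ := Finset.mem_filter.1 hu
    obtain ⟨hv, hSv⟩ := Finset.mem_filter.1 hv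
    -- Off `S`, the predicate `T` is replaced by its value at the end of `d`, so that it also
    -- respects the deleted edge.
    have := h.connected (fun w => if S w then T w else T (org (d.1, !d.2))) ?_ u hu v hv
      (by simpa [hSu] using hTu)
    · simpa [hSv] using this
    · intro y hy
      by_cases hyd : y.1 = d.1
      · rcases eq_or_eq_of_fst_eq hyd with rfl | rfl
        · simp [hSr, hSd]
        · simp [hSr, hSd]
      · have h₁ := hS y hy hyd
        by_cases hyS : S (org y)
        · simp only [hyS, h₁.1 hyS, if_true]
          exact hT y ((hmem y).2 ⟨hy, hyd, hyS⟩)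
        · simp only [hyS, mt h₁.2 hyS, if_false]
  constructor
  · intro y hy
    obtain ⟨hy, -, hyS⟩ := (hmem y).1 hy
    exact Finset.mem_filter.2 ⟨h.org_mem y hy, hyS⟩
  · intro y hy f hf
    obtain ⟨hy, -, hyS⟩ := (hmem y).1 hy
    exact Finset.mem_filter.2 ⟨h.reg_mem y hy f hf, y, hy, hf, hyS⟩
  · intro y
    have := h.deleteEdge_mem_iff hd y
    rw [hmem, hmem, ← and_assoc, ← and_assoc, ← and_comm (a := _ ≠ _), ← and_comm (a := _ ≠ _),
      ← Finset.mem_erase, ← Finset.mem_erase, this]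
    refine and_congr_right fun k => ?_
    rw [h.org_deleteEdge hd (Finset.mem_of_mem_erase k)]
  · exact fun y hy => h.org_deleteEdge hd ((hmem y).1 hy).1
  · intro y z hy hz hyz
    exact deleteEdge_sameCycle ((hmem y).1 hy).2.1 ((hmem z).1 hz).2.1
      (h.sameCycle y z ((hmem y).1 hy).1 ((hmem z).1 hz).1 hyz)
  · refine ⟨hnod.2.1, fun y => ?_, ?_⟩
    · rw [hmem]
      constructor
      · intro hy
        exact ⟨⟨hout y (.inl hy), hne y _ hy hdp hrp, hp₁ y hy⟩,
          ((h.outer.mem_iff y).1 (by simp [hy])).2⟩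
      · rintro ⟨⟨hy, hyd, hyS⟩, hyn⟩
        have := (h.outer.mem_iff y).2 ⟨hy, hyn⟩
        simp only [List.mem_append, List.mem_cons] at this
        rcases this with rfl | k | rfl | k
        exacts [(hyd rfl).elim, k, (hyd rfl).elim, (hp₂ y k hyS).elim]
    · exact (deleteEdge_isRerouting d φ).split (ne_reversal d) h.outer.cons_map_eq hdp hrp
  · intro f hf
    obtain ⟨hf, x, hx, hxf, hxS⟩ := Finset.mem_filter.1 hf
    obtain ⟨q, hq, hl⟩ := h.faces f hf
    have h₁ : reg d ≠ some f := by rw [hdn]; simp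
    have h₂ : reg (d.1, !d.2) ≠ some f := by rw [hrn]; simp
    refine ⟨q, hq.congr (fun y hy => ?_) fun y => ?_, hl⟩
    · exact h.follow_deleteEdge h₁ h₂ hy.1 hy.2
    · rw [hmem]
      constructor
      · rintro ⟨⟨k₁, -, -⟩, k₂⟩
        exact ⟨k₁, k₂⟩
      · rintro ⟨k₁, k₂⟩
        refine ⟨⟨k₁, fst_ne_of_reg_eq_some h₁ h₂ k₂, ?_⟩, k₂⟩
        exact (hq.forall_iff (Q := fun y => S (org y))
          (fun z hz => hstep z hz.1 (fst_ne_of_reg_eq_some h₁ h₂ hz.2)) ⟨hx, hxf⟩ ⟨k₁, k₂⟩).1 hxS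
  · rintro ⟨e, he⟩ rfl
    have h₁ : φ (d.1, !d.2) = (d.1, !d.2) := by simpa [follow] using hchain.1
    have horb : ∀ y : E × Bool, y.1 ∈ Es → org y = org (d.1, !d.2) → y.1 = d.1 := by
      intro y hy hyd
      refine (sameCycle_mem_iff (Q := fun y => y = (d.1, !d.2)) (fun y => ?_)
        (h.sameCycle (d.1, !d.2) y hd hy hyd.symm)).1 rfl ▸ rfl
      constructor
      · exact fun k => φ.injective (k.trans h₁.symm)
      · rintro rfl
        exact h₁
    obtain ⟨he', hed, heS⟩ := (hmem (e, true)).1 he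
    refine hed (horb _ he' (hconn (· = org (d.1, !d.2)) ?_ _
      (Finset.mem_filter.2 ⟨h.org_mem (d.1, !d.2) hd, hSr⟩) _
      (Finset.mem_filter.2 ⟨h.org_mem (e, true) he', heS⟩) rfl))
    intro y hy
    obtain ⟨hy, hyd, -⟩ := (hmem y).1 hy
    exact ⟨fun k => (hyd (horb y hy k)).elim, fun k => (hyd (horb (y.1, !y.2) hy k)).elim⟩
  · exact ⟨_, Finset.mem_filter.2 ⟨h.org_mem (d.1, !d.2) hd, hSr⟩⟩
  · exact hconn

/-- A spherical map is a disc diagram. -/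
theorem disc (n : ℕ) : ∀ {φ : Equiv.Perm (E × Bool)} {reg : E × Bool → Option F} {Vs : Finset V}
    {Es : Finset E} {Fs : Finset F} {p : List (E × Bool)},
    IsSurfaceMap P lab org φ reg Vs Es Fs p → Vs.card + Fs.card = Es.card + 1 → Es.card = n →
    Disc P (pathWord lab p) Vs.card Es.card Fs.card := by
  classical
  induction n using Nat.strong_induction_on with
  | _ n ih =>
  intro φ reg Vs Es Fs p h heul hn
  rcases p with _ | ⟨d, p⟩
  · have hE : Es = ∅ := by
      by_contra hE
      exact h.outer_ne (Finset.nonempty_iff_ne_empty.2 hE) rfl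
    have hV : Vs.card = 1 := by
      obtain ⟨v, hv⟩ := h.nonempty
      refine Finset.card_eq_one.2 ⟨v, Finset.eq_singleton_iff_unique_mem.2 ⟨hv, fun u hu => ?_⟩⟩
      exact h.connected (· = v) (by simp [hE]) v hv u hu rfl
    subst hE
    rw [hV, Finset.card_empty] at heul ⊢
    obtain hF : Fs.card = 0 := by omega
    rw [hF]
    exact .nil
  · obtain ⟨hd, hdn⟩ := (h.outer.mem_iff d).1 (by simp)
    have hcard := Finset.card_erase_add_one hd
    rcases hr : reg (d.1, !d.2) with _ | f
    · obtain ⟨S, hSr, hSd, hS⟩ := h.card_add_card_le.2 heul d hd (hdn.trans hr.symm)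
      have hrp : (d.1, !d.2) ∈ p := by
        have := (h.outer.mem_iff (d.1, !d.2)).2 ⟨hd, hr⟩
        exact (List.mem_cons.1 this).resolve_left (ne_reversal d).symm
      obtain ⟨p₁, p₂, rfl⟩ := List.append_of_mem hrp
      have h₁ := h.delete_bridge rfl hSr hSd hS
      have hrot : (d :: (p₁ ++ (d.1, !d.2) :: p₂)).IsRotated ((d.1, !d.2) :: (p₂ ++ d :: p₁)) :=
        ⟨p₁.length + 1, by
          rw [← List.cons_append]
          exact List.rotate_append_length_eq (d :: p₁) ((d.1, !d.2) :: p₂)⟩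
      have h₂ : IsSurfaceMap P lab org (deleteEdge (d.1, !d.2) φ) reg (Vs.filter fun v => ¬ S v)
          ((Es.erase d.1).filter fun e => ¬ S (org (e, true)))
          (Fs.filter fun f => ∃ y, y.1 ∈ Es ∧ reg y = some f ∧ ¬ S (org y)) p₂ := by
        convert (h.rotate hrot).delete_bridge (S := fun v => ¬ S v) (d := (d.1, !d.2))
          (p₁ := p₂) (p₂ := p₁) (by simp) (by simpa using hSd) (by simpa using hSr)
          (fun y hy hyd => not_congr (hS y hy hyd))
      have hV := Finset.card_filter_add_card_filter_not (s := Vs) S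
      have hE := Finset.card_filter_add_card_filter_not (s := Es.erase d.1)
        (fun e => S (org (e, true)))
      have hF := Finset.card_filter_add_card_filter_not (s := Fs)
        (fun f => ∃ y, y.1 ∈ Es ∧ reg y = some f ∧ S (org y))
      have hF' : (Fs.filter fun f => ¬ ∃ y, y.1 ∈ Es ∧ reg y = some f ∧ S (org y)) =
          Fs.filter fun f => ∃ y, y.1 ∈ Es ∧ reg y = some f ∧ ¬ S (org y) := by
        refine Finset.filter_congr fun f hf => ?_
        obtain ⟨x, hx, hxf⟩ := h.exists_dart hf
        constructor
        · exact fun k => ⟨x, hx, hxf, fun hxS => k ⟨x, hx, hxf, hxS⟩⟩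
        · rintro ⟨y, hy, hyf, hyS⟩ ⟨z, hz, hzf, hzS⟩
          obtain ⟨q, hq, -⟩ := h.faces f hf
          refine hyS ((hq.forall_iff (Q := fun y => S (org y)) (fun w hw => ?_)
            ⟨hz, hzf⟩ ⟨hy, hyf⟩).1 hzS)
          rw [h.org_follow hw.1]
          refine (hS w hw.1 fun k => ?_).symm
          rcases eq_or_eq_of_fst_eq k with rfl | rfl
          · rw [hdn] at hw; simp at hw
          · rw [hr] at hw; simp at hw
      rw [hF'] at hF
      -- Both halves satisfy `V + F ≤ E + 1`. The cells add up to those of the whole map less one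
      -- edge, so both inequalities are equalities and the halves are spherical again.
      have hle₁ := h₁.card_add_card_le.1
      have hle₂ := h₂.card_add_card_le.1
      have hd₁ := ih _ (by omega) h₁ (by omega) rfl
      have hd₂ := ih _ (by omega) h₂ (by omega) rfl
      have := hd₁.bridge (x := (lab d.1, d.2)) hd₂
      rw [hV, hE, hF, hcard] at this
      simpa [pathWord] using this
    · obtain ⟨u, hl, hu⟩ := h.delete_face rfl hr
      have hf := h.reg_mem (d.1, !d.2) hd f hr
      have hcardF := Finset.card_erase_add_one hf
      have := ih _ (by omega) hu (by omega) rfl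
      have := Disc.face (x := (lab d.1, d.2)) (U := pathWord lab u) (W := pathWord lab p)
        (by simpa [pathWord] using this) (by simpa [pathWord] using hl)
      rw [hcard, hcardF] at this
      simpa [pathWord] using this

end IsSurfaceMap

namespace Diagram

variable {P : Presentation A}

theorem exists_disc {Δ : Diagram A} (h : Δ.IsOver P) {W : Word A} (hW : Δ.HasBoundaryLabel W) :
    Disc P W (Δ.cells 0) (Δ.cells 1) (Δ.cells 2) := by
  obtain ⟨p, hp, rfl⟩ := hW
  have := Δ.finite_vertex
  have := Δ.finite_edge
  have := Δ.finite_face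
  have := Fintype.ofFinite Δ.Vertex
  have := Fintype.ofFinite Δ.Edge
  have := Fintype.ofFinite Δ.Face
  -- The rotation around the vertices is `next` after reversal, and reversing once more recovers
  -- `next`.
  have hfol : follow (Δ.next * reversal Δ.Edge) = Δ.next := by
    funext d
    simp [follow]
  have hmap : IsSurfaceMap P Δ.label Δ.origin (Δ.next * reversal Δ.Edge) Δ.region Finset.univ
      Finset.univ Finset.univ p := by
    refine ⟨by simp, by simp, by simp, fun d _ => ?_, fun d d' _ _ hd => ?_, ?_, fun f _ => ?_,
      ?_, ?_, ?_⟩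
    · exact (Δ.vertex_cycle (Δ.origin d)).1.mapsTo rfl
    · exact (Δ.vertex_cycle (Δ.origin d')).2 hd rfl
    · rw [hfol]
      exact ⟨hp.1, by simpa using hp.2.1, hp.2.2⟩
    · obtain ⟨q, hq, hl⟩ := h f
      rw [hfol]
      exact ⟨q, ⟨hq.1, by simpa using hq.2.1, hq.2.2⟩, _, .refl _, hl⟩
    · rintro ⟨e, -⟩ rfl
      obtain ⟨d, hd⟩ := Δ.region_nonempty ⟨e⟩ none
      simpa using (hp.2.1 d).2 hd
    · have := Δ.nonempty
      exact Finset.univ_nonempty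
    · intro S hS u _ v _ hu
      induction Δ.connected u v with
      | refl => exact hu
      | tail _ hxy ih =>
        obtain ⟨d, rfl, rfl⟩ := hxy
        exact (hS d (Finset.mem_univ _)).1 (ih (Finset.mem_univ _))
  have heul := Δ.euler
  simp only [Nat.card_eq_fintype_card] at heul
  have := hmap.disc _ (by simpa using heul) rfl
  simpa [cells, word, pathWord] using this

end Diagram

variable {A : Type*} {V E F : Type}

/-! ### From spherical maps to diagrams -/

namespace IsSurfaceMap

variable {P : Presentation A} {lab : E → A} {org : E × Bool → V}
  {φ : Equiv.Perm (E × Bool)} {reg : E × Bool → Option F} {Vs : Finset V} {Es : Finset E}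
  {Fs : Finset F} {p : List (E × Bool)}

theorem exists_isWalk_next (h : IsSurfaceMap P lab org φ reg Vs Es Fs p) {r : Option Fs}
    {q : List (E × Bool)}
    (hq : IsWalk (follow φ) (fun y => y.1 ∈ Es ∧ reg y = r.map Subtype.val) q) :
    ∃ q', q'.map dartVal = q ∧ IsWalk h.next (fun d => h.region d = r) q' := by
  obtain ⟨q', rfl⟩ := exists_map_dartVal fun d hd => ((hq.mem_iff d).1 hd).1
  refine ⟨q', rfl, hq.nodup.of_map _, fun d => ?_, ?_⟩
  · rw [← List.mem_map_of_injective dartVal_injective, hq.mem_iff, ← h.map_region,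
      (Option.map_injective Subtype.val_injective).eq_iff]
    exact and_iff_right d.1.2
  · apply List.map_injective_iff.2 dartVal_injective
    rw [List.map_rotate, ← hq.map_eq, List.map_map, List.map_map]
    rfl

/-- A spherical map as a diagram. -/
noncomputable def toDiagram (h : IsSurfaceMap P lab org φ reg Vs Es Fs p)
    (heul : Vs.card + Fs.card = Es.card + 1) : Diagram A where
  Vertex := Vs
  Edge := Es
  Face := Fs
  finite_vertex := inferInstance
  finite_edge := inferInstance
  finite_face := inferInstance
  label e := lab e
  origin := h.origin
  region := h.region
  next := h.next
  vertex_cycle := by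
    have hval : ∀ d, dartVal ((h.next * reversal Es) d) = φ (dartVal d) := fun d => by
      rw [Equiv.Perm.mul_apply, dartVal_next, follow, reversal_apply]
      simp [dartVal]
    refine isCycleOn_fiber (fun d => Subtype.ext ?_) fun d d' hd => ?_
    · change org (dartVal _) = org (dartVal d)
      rw [hval, h.org_eq _ d.1.2]
    · exact sameCycle_of_semiconj dartVal_injective hval
        (h.sameCycle _ _ d.1.2 d'.1.2 (congrArg Subtype.val hd))
  region_cycle := by
    refine isCycleOn_fiber (fun d => h.region_inj.2 (h.reg_follow d.1.2)) fun d d' hd => ?_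
    obtain ⟨q, hq⟩ := h.exists_walk d.1.2 (d := dartVal d)
    rw [← h.map_region] at hq
    obtain ⟨q', -, hq'⟩ := h.exists_isWalk_next hq
    exact hq'.sameCycle rfl hd.symm
  region_nonempty := fun ⟨e⟩ r => h.exists_region ⟨e, e.2⟩ r
  nonempty := h.nonempty.to_subtype
  connected u v := by
    refine h.connected (fun w => ∀ hw, Relation.ReflTransGen
      (fun x y => ∃ d, h.origin d = x ∧ h.origin (reversal Es d) = y) u ⟨w, hw⟩) ?_ u u.2 v v.2
      (fun _ => .refl) v.2
    have key : ∀ d : E × Bool, d.1 ∈ Es → (∀ hw, Relation.ReflTransGen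
        (fun x y => ∃ d, h.origin d = x ∧ h.origin (reversal Es d) = y) u ⟨org d, hw⟩) →
        ∀ hw, Relation.ReflTransGen (fun x y => ∃ d, h.origin d = x ∧
          h.origin (reversal Es d) = y) u ⟨org (d.1, !d.2), hw⟩ := fun d hd k hw =>
      (k (h.org_mem d hd)).tail ⟨(⟨d.1, hd⟩, d.2), rfl, rfl⟩
    exact fun d hd => ⟨key d hd, fun k => by simpa using key (d.1, !d.2) hd k⟩
  euler := by simpa using heul

theorem toDiagram_cells (h : IsSurfaceMap P lab org φ reg Vs Es Fs p)
    (heul : Vs.card + Fs.card = Es.card + 1) (j : Fin 3) :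
    (h.toDiagram heul).cells j = ![Vs.card, Es.card, Fs.card] j := by
  simp [Diagram.cells, toDiagram]

theorem toDiagram_word (h : IsSurfaceMap P lab org φ reg Vs Es Fs p)
    (heul : Vs.card + Fs.card = Es.card + 1) (q : List (Es × Bool)) :
    (h.toDiagram heul).word q = pathWord lab (q.map dartVal) := by
  rw [pathWord, List.map_map]
  rfl

theorem toDiagram_isOver (h : IsSurfaceMap P lab org φ reg Vs Es Fs p)
    (heul : Vs.card + Fs.card = Es.card + 1) : (h.toDiagram heul).IsOver P := by
  rintro ⟨f, hf⟩
  obtain ⟨q, hq, r, hr, hrP⟩ := h.faces f hf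
  obtain ⟨q', rfl, hq'⟩ := h.exists_isWalk_next (r := some ⟨f, hf⟩) hq
  obtain ⟨n, hn⟩ := hr.symm
  have hq'' := hq'.rotate n
  refine ⟨q'.rotate n, ⟨hq''.nodup, hq''.mem_iff, hq''.map_eq⟩, ?_⟩
  have : (h.toDiagram heul).word (q'.rotate n) = r := by
    rw [toDiagram_word, List.map_rotate, ← hn, pathWord, pathWord, List.map_rotate]
  rwa [this]

theorem toDiagram_hasBoundaryLabel (h : IsSurfaceMap P lab org φ reg Vs Es Fs p)
    (heul : Vs.card + Fs.card = Es.card + 1) :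
    (h.toDiagram heul).HasBoundaryLabel (pathWord lab p) := by
  obtain ⟨q', hq, hq'⟩ := h.exists_isWalk_next (r := none) h.outer
  refine ⟨q', ⟨hq'.nodup, hq'.mem_iff, hq'.map_eq⟩, ?_⟩
  rw [toDiagram_word, hq]

/-- The map with one vertex and no edges. -/
theorem point (P : Presentation A) (lab : E → A) (v : V) :
    IsSurfaceMap P lab (fun _ => v) 1 (fun _ => (none : Option F)) {v} ∅ ∅ [] := by
  constructor <;> simp
  · exact ⟨List.nodup_nil, by simp, rfl⟩

theorem isRotationSystem (h : IsSurfaceMap P lab org φ reg Vs Es Fs p)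
    (hfix : ∀ d, d.1 ∉ Es → φ d = d) : IsRotationSystem φ (fun d => d.1 ∈ Es) org :=
  ⟨h.mem_iff, h.org_eq, h.sameCycle, hfix⟩

/-- New edges are attached at the start of the outer walk, before its first oriented edge. If the
walk is empty, the map is a single point, and the default `d` stands for insertion into an empty
cyclic order. -/
theorem exists_corner (h : IsSurfaceMap P lab org φ reg Vs Es Fs p) (d : E × Bool) :
    ∃ v ∈ Vs, ((p.headD d).1 ∈ Es ∧ org (p.headD d) = v ∨
      p.headD d = d ∧ ∀ y : E × Bool, y.1 ∈ Es → org y ≠ v) := by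
  rcases p with _ | ⟨c, p⟩
  · have hE : Es = ∅ := by
      by_contra hE
      exact h.outer_ne (Finset.nonempty_iff_ne_empty.2 hE) rfl
    obtain ⟨v, hv⟩ := h.nonempty
    exact ⟨v, hv, .inr ⟨rfl, by simp [hE]⟩⟩
  · have hc := ((h.outer.mem_iff c).1 (by simp)).1
    exact ⟨org c, h.org_mem c hc, .inl ⟨hc, rfl⟩⟩

end IsSurfaceMap

variable {A : Type*} {V E F : Type}

/-! ### Adding spikes and faces along the outer boundary -/

section Addition

variable [DecidableEq E]

/-- The cyclic orders around the vertices after the addition of the edge of `d`, where `d` and its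
reverse are inserted before `c` and `c'`. -/
def addEdge (d c c' : E × Bool) (φ : Equiv.Perm (E × Bool)) : Equiv.Perm (E × Bool) :=
  insertBefore c' (d.1, !d.2) (insertBefore c d φ)

section

variable {φ : Equiv.Perm (E × Bool)} {d c c' : E × Bool}

theorem insertBefore_reversal (hr : φ (d.1, !d.2) = (d.1, !d.2)) (hd : φ d = d)
    (hc : c ≠ (d.1, !d.2)) : insertBefore c d φ (d.1, !d.2) = (d.1, !d.2) := by
  rw [insertBefore_apply hd, hr, if_neg hc.symm, if_neg (ne_reversal d).symm]

theorem follow_addEdge_self (hr : φ (d.1, !d.2) = (d.1, !d.2)) (hd : φ d = d)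
    (hc : c ≠ (d.1, !d.2)) : follow (addEdge d c c' φ) d = c' := by
  have h := insertBefore_reversal hr hd hc
  rw [follow, addEdge, insertBefore_apply h, h, if_pos rfl]
  exact ite_eq_right_iff.2 id

theorem follow_addEdge_reversal (hr : φ (d.1, !d.2) = (d.1, !d.2)) (hd : φ d = d)
    (hc : c ≠ (d.1, !d.2)) :
    follow (addEdge d c c' φ) (d.1, !d.2) = if c = c' then (d.1, !d.2) else c := by
  have h := insertBefore_reversal hr hd hc
  have h' : insertBefore c d φ d = c := by
    rw [insertBefore_apply hd, hd, if_pos rfl]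
    exact ite_eq_right_iff.2 id
  simp only [follow, Bool.not_not, Prod.mk.eta]
  rw [addEdge, insertBefore_apply h, h', if_neg (ne_reversal d)]

theorem follow_addEdge (hr : φ (d.1, !d.2) = (d.1, !d.2)) (hd : φ d = d)
    (hc : c ≠ (d.1, !d.2)) {y : E × Bool} (hy : y.1 ≠ d.1) :
    follow (addEdge d c c' φ) y =
      if (if follow φ y = c then d else follow φ y) = c' then (d.1, !d.2)
      else (if follow φ y = c then d else follow φ y) := by
  have h := insertBefore_reversal hr hd hc
  have h₁ : (y.1, !y.2) ≠ d := fun k => hy (by rw [← k])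
  have h₂ : (y.1, !y.2) ≠ (d.1, !d.2) := fun k => hy (congrArg (fun z => z.1) k :)
  rw [follow, addEdge, insertBefore_apply h, insertBefore_apply hd, if_neg h₁, if_neg h₂]
  rfl

end

namespace IsSurfaceMap

variable {P : Presentation A} {lab : E → A} {org : E × Bool → V}
  {φ : Equiv.Perm (E × Bool)} {reg : E × Bool → Option F} {Vs : Finset V} {Es : Finset E}
  {Fs : Finset F} {p : List (E × Bool)}

theorem isRotationSystem_addEdge (h : IsSurfaceMap P lab org φ reg Vs Es Fs p)
    (hfix : ∀ d, d.1 ∉ Es → φ d = d) {d c c' : E × Bool} (hd : d.1 ∉ Es) {org' : E × Bool → V}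
    (ho : ∀ y, y.1 ∈ Es → org' y = org y)
    (hc : c.1 ∈ Es ∧ org c = org' d ∨ c = d ∧ ∀ y : E × Bool, y.1 ∈ Es → org y ≠ org' d)
    (hc' : (c'.1 ∈ Es ∨ c' = d) ∧ org' c' = org' (d.1, !d.2) ∨
      c' = (d.1, !d.2) ∧ ∀ y : E × Bool, y.1 ∈ Es ∨ y = d → org' y ≠ org' (d.1, !d.2)) :
    IsRotationSystem (addEdge d c c' φ) (fun y => y.1 ∈ insert d.1 Es) org' := by
  have h₁ := (h.isRotationSystem hfix).insertBefore hd ho hc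
  have h₂ := h₁.insertBefore (x := (d.1, !d.2)) (o' := org')
    (by simpa [hd] using (ne_reversal d).symm) (fun _ _ => rfl) hc'
  have hs : (fun y : E × Bool => y.1 ∈ insert d.1 Es) =
      fun y => (y.1 ∈ Es ∨ y = d) ∨ y = (d.1, !d.2) := by
    funext y
    rw [Finset.mem_insert, or_assoc, or_comm]
    refine propext (or_congr_right ⟨eq_or_eq_of_fst_eq, ?_⟩)
    rintro (rfl | rfl) <;> rfl
  rw [hs]
  exact h₂

omit [DecidableEq E] in
theorem pathWord_congr {lab lab' : E → A} (hlab : ∀ e ∈ Es, lab' e = lab e)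
    {q : List (E × Bool)} (hq : ∀ y ∈ q, y.1 ∈ Es) : pathWord lab' q = pathWord lab q :=
  List.map_congr_left fun y hy => by rw [hlab _ (hq y hy)]

theorem follow_addEdge_of_reg (h : IsSurfaceMap P lab org φ reg Vs Es Fs p)
    (hfix : ∀ d, d.1 ∉ Es → φ d = d) {d c c' : E × Bool} (hd : d.1 ∉ Es)
    (hc : c ∈ p ∨ c = d) (hc' : c' ∈ p ∨ c'.1 = d.1) {y : E × Bool} (hy : y.1 ∈ Es)
    (hyp : reg y ≠ none) : follow (addEdge d c c' φ) y = follow φ y := by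
  have hcr : c ≠ (d.1, !d.2) := by
    rintro rfl
    rcases hc with hc | hc
    · exact hd ((h.outer.mem_iff _).1 hc).1
    · exact ne_reversal d hc.symm
  have hE := h.follow_mem hy
  have hne : ∀ x, x ∈ p ∨ x.1 = d.1 → follow φ y ≠ x := by
    rintro x (hx | hx) rfl
    · exact hyp ((h.reg_follow hy).symm.trans ((h.outer.mem_iff _).1 hx).2)
    · exact hd (hx ▸ hE)
  rw [follow_addEdge (hfix (d.1, !d.2) hd) (hfix d hd) hcr fun k => hd (k ▸ hy),
    if_neg (hne c (hc.imp_right fun k => congrArg _ k)), if_neg (hne c' hc')]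

/-- The new edge leads from the first corner of the outer walk to a new vertex; its reverse is
inserted before itself, being alone there. -/
theorem add_spike [DecidableEq V] (h : IsSurfaceMap P lab org φ reg Vs Es Fs p)
    (hfix : ∀ d, d.1 ∉ Es → φ d = d) {d : E × Bool} (hd : d.1 ∉ Es) {v₀ : V} (hv₀ : v₀ ∉ Vs)
    (a : A) : ∃ lab' org' φ' reg', IsSurfaceMap P lab' org' φ' reg' (insert v₀ Vs)
      (insert d.1 Es) Fs (d :: (d.1, !d.2) :: p) ∧ (∀ y, y.1 ∉ insert d.1 Es → φ' y = y) ∧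
      (∀ e ∈ Es, lab' e = lab e) ∧ lab' d.1 = a := by
  obtain ⟨v, hv, hc⟩ := h.exists_corner d
  have hrd := ne_reversal d
  have hfd := hfix d hd
  have hfr := hfix (d.1, !d.2) hd
  have hdp : ∀ y : E × Bool, y.1 = d.1 → y ∉ p := fun y hy k =>
    hd (hy ▸ ((h.outer.mem_iff y).1 k).1)
  have hc₀ : p.headD d ∈ p ∨ p.headD d = d := by
    rcases p with _ | ⟨c, p⟩ <;> simp
  have hcr : p.headD d ≠ (d.1, !d.2) := by
    rcases hc₀ with k | k
    · exact fun k' => hdp (p.headD d) (by rw [k']) k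
    · rw [k]; exact hrd
  set org' : E × Bool → V := fun y => if y = d then v else if y = (d.1, !d.2) then v₀ else org y
    with horg'
  have ho : ∀ y : E × Bool, y.1 ∈ Es → org' y = org y := by
    intro y hy
    have h₁ : y ≠ d := fun k => hd (k ▸ hy)
    have h₂ : y ≠ (d.1, !d.2) := fun k => hd (by rw [k] at hy; exact hy)
    simp [horg', h₁, h₂]
  have hod : org' d = v := by simp [horg']
  have hor : org' (d.1, !d.2) = v₀ := by simp [horg', hrd.symm]
  have hrot := h.isRotationSystem_addEdge hfix hd (c := p.headD d) (c' := (d.1, !d.2)) ho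
    (by rwa [hod]) (by
      refine .inr ⟨rfl, ?_⟩
      rintro y (hy | rfl)
      · rw [ho y hy, hor]
        exact ne_of_mem_of_not_mem (h.org_mem y hy) hv₀
      · rw [hod, hor]
        exact ne_of_mem_of_not_mem hv hv₀)
  refine ⟨Function.update lab d.1 a, org', addEdge d (p.headD d) (d.1, !d.2) φ,
    fun y => if y.1 = d.1 then none else reg y, ?_, hrot.fixed, fun e he => ?_, by simp⟩
  swap
  · exact Function.update_of_ne (ne_of_mem_of_not_mem he hd) _ _
  have hold : ∀ y : E × Bool, y.1 ∈ Es → y.1 ≠ d.1 := fun y hy k => hd (k ▸ hy)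
  constructor
  · intro y hy
    rcases Finset.mem_insert.1 hy with hy | hy
    · rcases eq_or_eq_of_fst_eq hy with rfl | rfl
      · rw [hod]; exact Finset.mem_insert_of_mem hv
      · rw [hor]; exact Finset.mem_insert_self _ _
    · rw [ho y hy]; exact Finset.mem_insert_of_mem (h.org_mem y hy)
  · intro y hy f hf
    split_ifs at hf with hyd
    exact h.reg_mem y ((Finset.mem_insert.1 hy).resolve_left hyd) f hf
  · exact hrot.mem_iff
  · exact hrot.map_eq
  · exact hrot.sameCycle
  · refine ⟨?_, fun y => ?_, ?_⟩
    · have := h.outer.nodup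
      simp [this, hdp d rfl, hdp (d.1, !d.2) rfl, hrd]
    · rw [List.mem_cons, List.mem_cons, Finset.mem_insert]
      by_cases hyd : y.1 = d.1
      · simp only [hyd, true_or, if_true, and_self, iff_true]
        exact (eq_or_eq_of_fst_eq hyd).imp_right .inl
      · have h₁ : y ≠ d := fun k => hyd (by rw [k])
        have h₂ : y ≠ (d.1, !d.2) := fun k => hyd (by rw [k])
        simp [h₁, h₂, hyd, h.outer.mem_iff]
    · rw [List.map_cons, List.map_cons, follow_addEdge_self hfr hfd hcr,
        follow_addEdge_reversal hfr hfd hcr, if_neg hcr]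
      rcases p with _ | ⟨c, l⟩
      · simp
      · rw [List.headD_cons] at hcr
        have := map_retarget (σ' := follow (addEdge d c (d.1, !d.2) φ)) (b' := d)
          (l := l) (b := c) (L := c :: l)
          (by simpa using h.outer.map_eq) ?_ ?_
        · simp only [List.headD_cons]
          rw [this]
          simp
        · intro y hy hyl
          have hyE := ((h.outer.mem_iff y).1 hy).1
          have h₁ : follow φ y ≠ c := fun k => (List.nodup_cons.1 h.outer.nodup).1 (k ▸ hyl)
          have h₂ : follow φ y ≠ (d.1, !d.2) := fun k =>
            hdp (d.1, !d.2) rfl (k ▸ List.mem_cons_of_mem _ hyl)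
          rw [follow_addEdge hfr hfd hcr (hold y hyE)]
          simp [h₁, h₂]
        · intro y hy hyc
          have hyE := ((h.outer.mem_iff y).1 hy).1
          rw [follow_addEdge hfr hfd hcr (hold y hyE)]
          simp [hyc, hrd]
  · intro f hf
    obtain ⟨q, hq, hl⟩ := h.faces f hf
    refine ⟨q, hq.congr (fun y hy => ?_) fun y => ?_, ?_⟩
    · exact h.follow_addEdge_of_reg hfix hd (c' := (d.1, !d.2)) hc₀ (.inr rfl) hy.1 (by rw [hy.2]; simp)
    · rw [Finset.mem_insert]
      by_cases hyd : y.1 = d.1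
      · simp [hyd, hd]
      · simp [hyd]
    · rwa [pathWord_congr (lab := lab) (Es := Es)]
      · intro e he
        exact Function.update_of_ne (ne_of_mem_of_not_mem he hd) _ _
      · exact fun y hy => ((hq.mem_iff y).1 hy).1
  · simp
  · exact Finset.insert_nonempty _ _
  · intro S hS
    have hSV := h.connected S fun y hy => by
      have := hS y (Finset.mem_insert_of_mem hy)
      rwa [ho y hy, ho (y.1, !y.2) hy] at this
    have hvv := hS d (Finset.mem_insert_self _ _)
    rw [hod, hor] at hvv
    intro u hu w hw hSu
    have hSv : S v := by
      rcases Finset.mem_insert.1 hu with rfl | hu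
      exacts [hvv.2 hSu, hSV u hu v hv hSu]
    rcases Finset.mem_insert.1 hw with rfl | hw
    exacts [hvv.1 hSv, hSV v hv w hw hSv]

/-- A new edge through the outer region, from the start of `u` to its end, cuts off a face bounded
by `u` and the reverse of `d`. If `w` is empty the edge is a loop: the default `w.headD d = d`
places its end next to its start. -/
theorem add_face [DecidableEq F] (h : IsSurfaceMap P lab org φ reg Vs Es Fs p)
    (hfix : ∀ d, d.1 ∉ Es → φ d = d) {d : E × Bool} (hd : d.1 ∉ Es) {f₀ : F} (hf₀ : f₀ ∉ Fs)
    (a : A) {u w : List (E × Bool)} (hp : p = u ++ w)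
    (hl : P.IsFaceLabel ((a, !d.2) :: pathWord lab u)) :
    ∃ lab' org' φ' reg', IsSurfaceMap P lab' org' φ' reg' Vs
      (insert d.1 Es) (insert f₀ Fs) (d :: w) ∧ (∀ y, y.1 ∉ insert d.1 Es → φ' y = y) ∧
      (∀ e ∈ Es, lab' e = lab e) ∧ lab' d.1 = a := by
  subst hp
  obtain ⟨v, hv, hc⟩ := h.exists_corner d
  have hrd := ne_reversal d
  have hfd := hfix d hd
  have hfr := hfix (d.1, !d.2) hd
  have hdp : ∀ y : E × Bool, y.1 = d.1 → y ∉ u ++ w := fun y hy k =>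
    hd (hy ▸ ((h.outer.mem_iff y).1 k).1)
  have hdu : ∀ y : E × Bool, y.1 = d.1 → y ∉ u := fun y hy k => hdp y hy (by simp [k])
  have hdw : ∀ y : E × Bool, y.1 = d.1 → y ∉ w := fun y hy k => hdp y hy (by simp [k])
  have hnod := List.nodup_append.1 h.outer.nodup
  have hold : ∀ y : E × Bool, y.1 ∈ Es → y.1 ≠ d.1 := fun y hy k => hd (k ▸ hy)
  have hout : ∀ y ∈ u ++ w, y.1 ∈ Es := fun y hy => ((h.outer.mem_iff y).1 hy).1
  have hu : ∀ y ∈ u, y.1 ∈ Es := fun y hy => hout y (by simp [hy])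
  have hw : ∀ y ∈ w, y.1 ∈ Es := fun y hy => hout y (by simp [hy])
  have hc₀ : (u ++ w).headD d ∈ u ++ w ∨ (u ++ w).headD d = d := by
    rcases u ++ w with _ | ⟨c, p⟩ <;> simp
  have hc₁ : w.headD d ∈ u ++ w ∨ (w.headD d).1 = d.1 := by
    rcases w with _ | ⟨c, p⟩ <;> simp
  have hcr : (u ++ w).headD d ≠ (d.1, !d.2) := by
    rcases hc₀ with k | k
    · exact fun k' => hdp ((u ++ w).headD d) (by rw [k']) k
    · rw [k]; exact hrd
  obtain ⟨v', hv', hc'⟩ : ∃ v' ∈ Vs, ((w.headD d).1 ∈ Es ∧ org (w.headD d) = v' ∨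
      w.headD d = d ∧ v' = v) := by
    rcases w with _ | ⟨k, w⟩
    · exact ⟨v, hv, .inr ⟨rfl, rfl⟩⟩
    · have hk := hw k (by simp)
      exact ⟨org k, h.org_mem k hk, .inl ⟨hk, rfl⟩⟩
  set org' : E × Bool → V := fun y => if y = d then v else if y = (d.1, !d.2) then v' else org y
    with horg'
  have hodd : ∀ y : E × Bool, y.1 ∈ Es → y ≠ d ∧ y ≠ (d.1, !d.2) := fun y hy =>
    ⟨fun k => hd (k ▸ hy), fun k => hd (by rw [k] at hy; exact hy)⟩
  have ho : ∀ y : E × Bool, y.1 ∈ Es → org' y = org y := by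
    intro y hy
    simp [horg', hodd y hy]
  have hod : org' d = v := by simp [horg']
  have hor : org' (d.1, !d.2) = v' := by simp [horg', hrd.symm]
  have hrot := h.isRotationSystem_addEdge hfix hd (c := (u ++ w).headD d) (c' := w.headD d) ho
    (by rwa [hod]) (by
      rcases hc' with ⟨k₁, k₂⟩ | ⟨k₁, k₂⟩
      · exact .inl ⟨.inl k₁, by rw [ho _ k₁, k₂, hor]⟩
      · exact .inl ⟨.inr k₁, by rw [k₁, hod, hor, k₂]⟩)
  obtain ⟨σ', hσ'⟩ : ∃ σ', σ' = follow (addEdge d ((u ++ w).headD d) (w.headD d) φ) := ⟨_, rfl⟩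
  have hfol : ∀ y : E × Bool, y.1 ∈ Es → σ' y =
      if (if follow φ y = (u ++ w).headD d then d else follow φ y) = w.headD d then (d.1, !d.2)
      else (if follow φ y = (u ++ w).headD d then d else follow φ y) := fun y hy => by
    rw [hσ', follow_addEdge hfr hfd hcr (hold y hy)]
  -- The old outer walk `u w` is cut at the two corners: the last step of `w` now leads to `d`, that
  -- of `u` to the reverse of `d`.
  have hwalks : σ' d :: w.map σ' = w ++ [d] ∧
      σ' (d.1, !d.2) :: u.map σ' = u ++ [(d.1, !d.2)] := by
    have h₀ : σ' d = w.headD d ∧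
        σ' (d.1, !d.2) = if (u ++ w).headD d = w.headD d then (d.1, !d.2)
          else (u ++ w).headD d := by
      rw [hσ', follow_addEdge_self hfr hfd hcr, follow_addEdge_reversal hfr hfd hcr]
      exact ⟨rfl, rfl⟩
    rw [h₀.1, h₀.2]
    have hmap := h.outer.map_eq
    rcases u with _ | ⟨b, u⟩ <;> rcases w with _ | ⟨k, w⟩
    · simp
    · have := map_retarget (σ' := σ') (L := k :: w) (l := w) (b := k) (b' := d) (by simpa using hmap)
        (fun y hy hyl => ?_) (fun y hy hyk => ?_)
      · exact ⟨by rw [this]; rfl, by simp⟩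
      · have h₁ : follow φ y ≠ k := fun k' => (List.nodup_cons.1 hnod.2.1).1 (k' ▸ hyl)
        rw [hfol y (hw y hy)]
        simp [h₁]
      · have h₁ : d ≠ k := fun k' => hdw d rfl (by simp [k'])
        rw [hfol y (hw y hy)]
        simp [hyk, h₁]
    · have := map_retarget (σ' := σ') (L := b :: u) (l := u) (b := b) (b' := (d.1, !d.2))
        (by simpa using hmap) (fun y hy hyl => ?_) (fun y hy hyk => ?_)
      · have h₁ : b ≠ d := fun k' => hdu d rfl (by simp [k'])
        exact ⟨rfl, by rw [this]; simp [h₁]⟩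
      · have h₁ : follow φ y ≠ b := fun k' => (List.nodup_cons.1 hnod.1).1 (k' ▸ hyl)
        have h₂ : follow φ y ≠ d := fun k' =>
          hdu (follow φ y) (by rw [k']) (List.mem_cons_of_mem _ hyl)
        rw [hfol y (hu y hy)]
        simp [h₁, h₂]
      · rw [hfol y (hu y hy)]
        simp [hyk]
    · have hbk : b ≠ k := hnod.2.2 b (by simp) k (by simp)
      have hmap' : (b :: u).map (follow φ) = u ++ [k] ∧
          (k :: w).map (follow φ) = w ++ [b] := by
        have : (b :: u).map (follow φ) ++ (k :: w).map (follow φ) = (u ++ [k]) ++ (w ++ [b]) := by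
          simpa using hmap
        exact List.append_inj this (by simp)
      have h₁ := map_retarget (σ' := σ') (b' := (d.1, !d.2)) hmap'.1 (fun y hy hyl => ?_)
        (fun y hy hyk => ?_)
      have h₂ := map_retarget (σ' := σ') (b' := d) hmap'.2 (fun y hy hyl => ?_) (fun y hy hyk => ?_)
      · exact ⟨by rw [h₂]; rfl, by rw [h₁]; simp [hbk]⟩
      · have h₁ : follow φ y ≠ k := fun k' => (List.nodup_cons.1 hnod.2.1).1 (k' ▸ hyl)
        have h₂ : follow φ y ≠ b := fun k' => hnod.2.2 (follow φ y) (by simp [k'])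
          (follow φ y) (by simp [hyl]) rfl
        rw [hfol y (hw y hy)]
        simp [h₁, h₂]
      · have h₁ : d ≠ k := fun k' => hdw d rfl (by simp [k'])
        rw [hfol y (hw y hy)]
        simp [hyk, h₁]
      · have h₁ : follow φ y ≠ b := fun k' => (List.nodup_cons.1 hnod.1).1 (k' ▸ hyl)
        have h₂ : follow φ y ≠ k := fun k' => hnod.2.2 (follow φ y) (by simp [hyl])
          (follow φ y) (by simp [k']) rfl
        rw [hfol y (hu y hy)]
        simp [h₁, h₂]
      · rw [hfol y (hu y hy)]
        simp [hyk, hbk.symm]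
  subst hσ'
  have hlab : ∀ e ∈ Es, Function.update lab d.1 a e = lab e := fun e he =>
    Function.update_of_ne (ne_of_mem_of_not_mem he hd) _ _
  refine ⟨Function.update lab d.1 a, org', addEdge d ((u ++ w).headD d) (w.headD d) φ,
    fun y => if y = d then none else if y = (d.1, !d.2) ∨ y ∈ u then some f₀ else reg y, ?_,
    hrot.fixed, hlab, by simp⟩
  have hreg : ∀ y : E × Bool, y.1 ∈ Es → (if y = d then none else
      if y = (d.1, !d.2) ∨ y ∈ u then some f₀ else reg y) = if y ∈ u then some f₀ else reg y := by
    intro y hy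
    simp [hodd y hy]
  constructor
  · intro y hy
    rcases Finset.mem_insert.1 hy with hy | hy
    · rcases eq_or_eq_of_fst_eq hy with rfl | rfl
      · rwa [hod]
      · rwa [hor]
    · rw [ho y hy]; exact h.org_mem y hy
  · intro y hy f hf
    rcases Finset.mem_insert.1 hy with hy | hy
    · rcases eq_or_eq_of_fst_eq hy with rfl | rfl
      · simp at hf
      · simp only [hrd.symm, true_or, if_true, if_false, Option.some.injEq] at hf
        simp [hf]
    · rw [hreg y hy] at hf
      split_ifs at hf
      · simp only [Option.some.injEq] at hf
        simp [hf]
      · exact Finset.mem_insert_of_mem (h.reg_mem y hy f hf)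
  · exact hrot.mem_iff
  · exact hrot.map_eq
  · exact hrot.sameCycle
  · refine ⟨List.nodup_cons.2 ⟨hdw d rfl, hnod.2.1⟩, fun y => ?_, by simpa using hwalks.1⟩
    rw [List.mem_cons, Finset.mem_insert]
    by_cases hyd : y.1 = d.1
    · rcases eq_or_eq_of_fst_eq hyd with rfl | rfl
      · simp
      · simp [hdw (d.1, !d.2) rfl, hrd.symm]
    · have h₁ := h.outer.mem_iff y
      have h₂ : y ≠ d := fun k => hyd (by rw [k])
      have h₃ : y ≠ (d.1, !d.2) := fun k => hyd (by rw [k])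
      by_cases hyu : y ∈ u
      · have : y ∉ w := fun k => hnod.2.2 y hyu y k rfl
        simp [h₂, hyu, this]
      · simp only [List.mem_append, hyu, false_or] at h₁
        simp [h₂, h₃, hyu, hyd, h₁]
  · intro f hf
    rcases Finset.mem_insert.1 hf with rfl | hf
    · refine ⟨(d.1, !d.2) :: u, ⟨List.nodup_cons.2 ⟨hdu _ rfl, hnod.1⟩, fun y => ?_,
        by simpa using hwalks.2⟩, ?_⟩
      · rw [List.mem_cons, Finset.mem_insert]
        by_cases hyd : y.1 = d.1
        · rcases eq_or_eq_of_fst_eq hyd with rfl | rfl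
          · simp [hrd, hdu y rfl]
          · simp [hrd.symm]
        · have h₂ : y ≠ d := fun k => hyd (by rw [k])
          have h₃ : y ≠ (d.1, !d.2) := fun k => hyd (by rw [k])
          by_cases hyu : y ∈ u
          · simp [h₂, hyu, hu y hyu]
          · simp only [h₂, h₃, hyu, hyd, false_or, or_false, if_false, false_iff, not_and]
            exact fun k₁ k₂ => hf₀ (h.reg_mem y k₁ _ k₂)
      · have h₁ : pathWord (Function.update lab d.1 a) ((d.1, !d.2) :: u) =
            (a, !d.2) :: pathWord (Function.update lab d.1 a) u := by simp [pathWord]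
        rwa [h₁, pathWord_congr hlab hu]
    · obtain ⟨q, hq, hl'⟩ := h.faces f hf
      have hff : f₀ ≠ f := fun k => hf₀ (k ▸ hf)
      refine ⟨q, hq.congr (fun y hy => ?_) fun y => ?_, ?_⟩
      · exact h.follow_addEdge_of_reg hfix hd hc₀ hc₁ hy.1 (by rw [hy.2]; simp)
      · rw [Finset.mem_insert]
        by_cases hyd : y.1 = d.1
        · rcases eq_or_eq_of_fst_eq hyd with rfl | rfl
          · simp [hd]
          · simp [hd, hrd.symm, hff]
        · have h₂ : y ≠ d := fun k => hyd (by rw [k])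
          have h₃ : y ≠ (d.1, !d.2) := fun k => hyd (by rw [k])
          by_cases hyu : y ∈ u
          · have := ((h.outer.mem_iff y).1 (by simp [hyu])).2
            simp [h₂, hyu, hff, this]
          · simp [h₂, h₃, hyu, hyd]
      · rwa [pathWord_congr hlab fun y hy => ((hq.mem_iff y).1 hy).1]
  · simp
  · exact h.nonempty
  · intro S hS
    refine h.connected S fun y hy => ?_
    have := hS y (Finset.mem_insert_of_mem hy)
    rwa [ho y hy, ho (y.1, !y.2) hy] at this

end IsSurfaceMap

end Addition

open FreeGroup (mk invRev)

/-! ### Every disc is realized by a diagram -/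

section Realization

variable {A : Type*}

/-- There is a spherical map over `P` with outer boundary label `W`, `e` edges and `f` faces, with
natural numbers as its cells. -/
def Realizable (P : Presentation A) (W : Word A) (e f : ℕ) : Prop :=
  ∃ (lab : ℕ → A) (org : ℕ × Bool → ℕ) (φ : Equiv.Perm (ℕ × Bool)) (reg : ℕ × Bool → Option ℕ)
    (Vs Es Fs : Finset ℕ) (p : List (ℕ × Bool)), IsSurfaceMap P lab org φ reg Vs Es Fs p ∧
    (∀ d, d.1 ∉ Es → φ d = d) ∧ pathWord lab p = W ∧ Vs.card + Fs.card = Es.card + 1 ∧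
    Es.card = e ∧ Fs.card = f

namespace Realizable

variable {P : Presentation A} {W : Word A} {e f : ℕ}

theorem nil [Nonempty A] : Realizable P [] 0 0 :=
  ⟨fun _ => Classical.arbitrary A, _, _, _, _, _, _, _, IsSurfaceMap.point P _ 0, by simp, rfl,
    rfl, rfl, rfl⟩

theorem of_isRotated (h : Realizable P W e f) {W' : Word A} (hW : W.IsRotated W') :
    Realizable P W' e f := by
  obtain ⟨lab, org, φ, reg, Vs, Es, Fs, p, h, hfix, rfl, h'⟩ := h
  obtain ⟨n, rfl⟩ := hW
  exact ⟨lab, org, φ, reg, Vs, Es, Fs, p.rotate n, h.rotate ⟨n, rfl⟩, hfix,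
    by rw [pathWord, List.map_rotate]; rfl, h'⟩

theorem spike (h : Realizable P W e f) (x : A × Bool) :
    Realizable P (x :: (x.1, !x.2) :: W) (e + 1) f := by
  obtain ⟨lab, org, φ, reg, Vs, Es, Fs, p, h, hfix, rfl, heul, rfl, rfl⟩ := h
  obtain ⟨v₀, hv₀⟩ := Infinite.exists_notMem_finset Vs
  obtain ⟨e₀, he₀⟩ := Infinite.exists_notMem_finset Es
  obtain ⟨lab', org', φ', reg', h', hfix', hlab, hx⟩ :=
    h.add_spike hfix (d := (e₀, x.2)) he₀ hv₀ x.1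
  refine ⟨lab', org', φ', reg', _, _, _, _, h', hfix', ?_, ?_, Finset.card_insert_of_notMem he₀,
    rfl⟩
  · have := IsSurfaceMap.pathWord_congr hlab fun y hy => ((h.outer.mem_iff y).1 hy).1
    simp only [pathWord, List.map_cons] at this hx ⊢
    rw [this, hx]
  · rw [Finset.card_insert_of_notMem he₀, Finset.card_insert_of_notMem hv₀]
    omega

theorem face {U : Word A} {x : A × Bool} (h : Realizable P (U ++ W) e f)
    (hl : P.IsFaceLabel ((x.1, !x.2) :: U)) : Realizable P (x :: W) (e + 1) (f + 1) := by
  obtain ⟨lab, org, φ, reg, Vs, Es, Fs, p, h, hfix, hp, heul, rfl, rfl⟩ := h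
  obtain ⟨f₀, hf₀⟩ := Infinite.exists_notMem_finset Fs
  obtain ⟨e₀, he₀⟩ := Infinite.exists_notMem_finset Es
  obtain ⟨u, w, rfl, rfl, rfl⟩ := List.map_eq_append_iff.1 hp
  obtain ⟨lab', org', φ', reg', h', hfix', hlab, hx⟩ :=
    h.add_face hfix (d := (e₀, x.2)) he₀ hf₀ x.1 rfl hl
  refine ⟨lab', org', φ', reg', _, _, _, _, h', hfix', ?_, ?_, Finset.card_insert_of_notMem he₀,
    Finset.card_insert_of_notMem hf₀⟩
  · have := IsSurfaceMap.pathWord_congr (q := w) hlab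
      fun y hy => ((h.outer.mem_iff y).1 (by simp [hy])).1
    simp only [pathWord, List.map_cons] at this hx ⊢
    rw [this, hx]
  · rw [Finset.card_insert_of_notMem he₀, Finset.card_insert_of_notMem hf₀]
    omega

end Realizable

variable {P : Presentation A}

/-- Growing `W` onto an arbitrary boundary `C` avoids gluing two maps at a bridge: `W₂` is grown
first, then the bridge is added as a spike, and after a rotation `W₁` is grown at its tip. -/
theorem Disc.realizable_append {W : Word A} {v e f : ℕ} (h : Disc P W v e f) {C : Word A}
    {e' f' : ℕ} (hC : Realizable P C e' f') : Realizable P (W ++ C) (e' + e) (f' + f) := by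
  induction h generalizing C e' f' with
  | nil => exact hC
  | @bridge x W₁ W₂ _ e₁ f₁ _ e₂ f₂ _ _ ih₁ ih₂ =>
    have h₁ : Realizable P ((x.1, !x.2) :: W₂ ++ C ++ [x]) (e' + e₂ + 1) (f' + f₂) :=
      ((ih₂ hC).spike x).of_isRotated ⟨1, by simp⟩
    have h₂ := (ih₁ h₁).of_isRotated (W' := x :: (W₁ ++ (x.1, !x.2) :: W₂) ++ C)
      (List.IsRotated.symm ⟨1, by simp⟩)
    rwa [show e' + (e₁ + e₂ + 1) = e' + e₂ + 1 + e₁ by omega,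
      show f' + (f₁ + f₂) = f' + f₂ + f₁ by omega]
  | face _ hl ih =>
    have := ih hC
    rw [List.append_assoc] at this
    exact this.face hl

theorem Disc.exists_diagram {W : Word A} {v e f : ℕ} (h : Disc P W v e f) :
    ∃ Δ : Diagram A, Δ.IsOver P ∧ Δ.HasBoundaryLabel W ∧ ∀ j, Δ.cells j = ![v, e, f] j := by
  have heul := h.euler
  rcases isEmpty_or_nonempty A with hA | hA
  -- Over an empty alphabet, ambient edges could not be labelled, so the point is taken with the
  -- empty type of edges.
  · cases h with
    | nil =>
      have hpt := IsSurfaceMap.point (E := Empty) (F := Empty) P Empty.elim ()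
      exact ⟨hpt.toDiagram rfl, hpt.toDiagram_isOver _, hpt.toDiagram_hasBoundaryLabel _,
        hpt.toDiagram_cells _⟩
    | @bridge x => exact hA.elim x.1
    | @face x => exact hA.elim x.1
  · obtain ⟨lab, org, φ, reg, Vs, Es, Fs, p, hmap, -, hp, heul', hE, hF⟩ :=
      h.realizable_append (.nil (P := P))
    rw [List.append_nil] at hp
    subst hp
    refine ⟨hmap.toDiagram heul', hmap.toDiagram_isOver _, hmap.toDiagram_hasBoundaryLabel _, fun j => ?_⟩
    rw [hmap.toDiagram_cells]
    have hV : Vs.card = v := by omega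
    rw [hV, hE, hF, zero_add, zero_add]

theorem Disc.minCells_le {W : Word A} {v e f : ℕ} (h : Disc P W v e f) (j : Fin 3) :
    minCells P j W ≤ ![v, e, f] j := by
  obtain ⟨Δ, h₁, h₂, h₃⟩ := h.exists_diagram
  exact Nat.sInf_le ⟨Δ, h₁, h₂, h₃ j⟩

/-- Since some diagram exists, the `sInf` is attained and is not the default value of an empty set.
-/
theorem exists_disc_minCells {W : Word A} (hW : mk W ∈ P.closure) (j : Fin 3) :
    ∃ v e f, Disc P W v e f ∧ minCells P j W = ![v, e, f] j := by
  obtain ⟨v, e, f, h⟩ := exists_disc_of_mem_closure hW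
  obtain ⟨Δ, h₁, h₂, h₃⟩ := h.exists_diagram
  obtain ⟨Δ', k₁, k₂, k₃⟩ : minCells P j W ∈ {n | ∃ Δ : Diagram A, Δ.IsOver P ∧
      Δ.HasBoundaryLabel W ∧ Δ.cells j = n} := Nat.sInf_mem ⟨_, Δ, h₁, h₂, rfl⟩
  refine ⟨_, _, _, Diagram.exists_disc k₁ k₂, ?_⟩
  rw [← k₃]
  fin_cases j <;> rfl

end Realization

/-! ### From bounds for single words to Dehn functions -/

section Dehn

variable {A : Type*} {P : Presentation A}

theorem dehn_le {j : Fin 3} {x N : ℕ}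
    (h : ∀ W : Word A, mk W ∈ P.closure → W.length ≤ x → minCells P j W ≤ N) :
    dehn P j x ≤ N := by
  refine csSup_le ⟨_, [], one_mem P.closure, Nat.zero_le _, rfl⟩ ?_
  rintro _ ⟨W, h₁, h₂, rfl⟩
  exact h W h₁ h₂

/-- Over a finite alphabet only finitely many words have length at most `x`, so the `sSup` is a true
maximum. -/
theorem minCells_le_dehn [Finite A] {j : Fin 3} {x : ℕ} {W : Word A} (h₁ : mk W ∈ P.closure)
    (h₂ : W.length ≤ x) : minCells P j W ≤ dehn P j x := by
  refine le_csSup (Set.Finite.bddAbove ?_) ⟨W, h₁, h₂, rfl⟩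
  refine ((List.finite_length_le (A × Bool) x).image (minCells P j)).subset ?_
  rintro _ ⟨W, -, h, rfl⟩
  exact ⟨W, h, rfl⟩

/-- The empty word is kept apart: its diagram may need a vertex although its length is zero. The
constant bound `K` is absorbed in the linear term because `1 ≤ x`. -/
theorem dominated_of_minCells_le {A A' : Type*} [Finite A] {P : Presentation A}
    {P' : Presentation A'} {i j : Fin 3} (K : ℕ)
    (h : ∀ W' : Word A', mk W' ∈ P'.closure → W'.length ≠ 0 → ∃ W : Word A, mk W ∈ P.closure ∧
      W.length ≤ W'.length ∧ minCells P' j W' ≤ K * minCells P i W + K * W'.length)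
    (h₀ : minCells P' j [] ≤ K) :
    Dominated (dehn P' j) (dehn P i) := by
  refine ⟨K + 1, K.succ_pos, fun x hx => dehn_le fun W' h₁ h₂ => ?_⟩
  by_cases hW' : W'.length = 0
  · rw [List.eq_nil_of_length_eq_zero hW']
    nlinarith
  · obtain ⟨W, k₁, k₂, k₃⟩ := h W' h₁ hW'
    have h₄ : minCells P i W ≤ dehn P i ((K + 1) * x) :=
      minCells_le_dehn k₁ (k₂.trans (h₂.trans (Nat.le_mul_of_pos_left _ K.succ_pos)))
    calc minCells P' j W' ≤ K * minCells P i W + K * W'.length := k₃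
      _ ≤ (K + 1) * dehn P i ((K + 1) * x) + (K + 1) * x := by gcongr <;> omega

end Dehn

/-! ### T-transformations -/

section TTransformation

variable {A : Type*} {P P' : Presentation A}

/-- A common relator costs one conjugate of its own length, and finitely many others remain. As
relators are nonempty, an absolute bound on `m` is also one proportional to the length. -/
theorem exists_relator_bound (hfin : (P.rels \ P'.rels).Finite) (hcl : P'.closure = P.closure) :
    ∃ K, ∀ r ∈ P.rels, ∃ n m, Area P' (mk r) n m ∧ n ≤ K ∧ m ≤ K * r.length := by
  have h : ∀ r : Word A, ∃ K, r ∈ P.rels → ∃ n m, Area P' (mk r) n m ∧ n ≤ K ∧ m ≤ K := by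
    intro r
    by_cases hr : r ∈ P.rels
    · have : mk r ∈ P'.closure := by
        rw [hcl]
        exact Subgroup.subset_normalClosure ⟨r, hr, rfl⟩
      obtain ⟨n, m, h⟩ := exists_area_of_mem_closure this
      exact ⟨n + m, fun _ => ⟨n, m, h, by omega, by omega⟩⟩
    · exact ⟨0, fun k => (hr k).elim⟩
  choose K hK using h
  obtain ⟨B, hB⟩ := (hfin.image K).bddAbove
  refine ⟨B + 1, fun r hr => ?_⟩
  have hlen : 0 < r.length := List.length_pos_of_ne_nil (P.rels_ne_nil r hr)
  by_cases hr' : r ∈ P'.rels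
  · exact ⟨1, r.length, .rel hr', by omega, Nat.le_mul_of_pos_left _ B.succ_pos⟩
  · obtain ⟨n, m, h, h₁, h₂⟩ := hK r hr
    have h₃ : K r ≤ B := hB ⟨r, ⟨hr, hr'⟩, rfl⟩
    exact ⟨n, m, h, by omega, (h₂.trans (by omega)).trans (Nat.le_mul_of_pos_right (B + 1) hlen)⟩

/-- One-sided: only the relators of `P` missing from `P'` must be finite in number, so it applies in
both directions of a T-transformation. -/
theorem dominated_of_finite_diff [Finite A] (hfin : (P.rels \ P'.rels).Finite)
    (hcl : P'.closure = P.closure) :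
    Dominated (dehn P' 0) (dehn P 1) ∧ Dominated (dehn P' 1) (dehn P 1) ∧
      Dominated (dehn P' 2) (dehn P 2) := by
  obtain ⟨K, hK⟩ := exists_relator_bound hfin hcl
  have key : ∀ {W : Word A} {v e f}, Disc P W v e f → ∃ v' e' f', Disc P' W v' e' f' ∧
      f' ≤ K * f ∧ e' ≤ K * e + W.length := by
    intro W v e f h
    obtain ⟨m, h₁, h₂⟩ := h.area
    obtain ⟨n', m', h₃, h₄, h₅⟩ := h₁.change_relators hK
    obtain ⟨v', e', f', h₆, h₇, h₈⟩ := h₃.exists_disc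
    refine ⟨v', e', f', h₆, h₇.trans h₄, ?_⟩
    -- The total perimeter `m` is at most `2 * e`, as each edge has two sides.
    have : K * m ≤ K * (2 * e) := Nat.mul_le_mul_left K (by omega)
    have : K * (2 * e) = 2 * (K * e) := by ring
    omega
  have hnil : ∀ j, minCells P' j [] ≤ 1 := fun j =>
    (Disc.minCells_le .nil j).trans (by fin_cases j <;> simp)
  refine ⟨dominated_of_minCells_le (K + 2) (fun W hW hW₀ => ⟨W, hcl ▸ hW, le_rfl, ?_⟩)
      ((hnil 0).trans (by omega)),
    dominated_of_minCells_le (K + 1) (fun W hW _ => ⟨W, hcl ▸ hW, le_rfl, ?_⟩)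
      ((hnil 1).trans (by omega)),
    dominated_of_minCells_le (K + 1) (fun W hW _ => ⟨W, hcl ▸ hW, le_rfl, ?_⟩)
      ((hnil 2).trans (by omega))⟩
  · obtain ⟨v, e, f, h, hm⟩ := exists_disc_minCells (P := P) (hcl ▸ hW) 1
    obtain ⟨v', e', f', h', hf, he⟩ := key h
    have h₀ := h'.minCells_le 0
    -- Euler's formula gives `v' ≤ e' + 1`. The extra `1` is at most `W.length`, whence the constant
    -- `K + 2` and the need for a nonempty word.
    have heul := h'.euler
    rw [hm]
    simp only [Matrix.cons_val] at h₀ ⊢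
    nlinarith [Nat.pos_of_ne_zero hW₀]
  · obtain ⟨v, e, f, h, hm⟩ := exists_disc_minCells (P := P) (hcl ▸ hW) 1
    obtain ⟨v', e', f', h', hf, he⟩ := key h
    have h₀ := h'.minCells_le 1
    rw [hm]
    simp only [Matrix.cons_val] at h₀ ⊢
    nlinarith
  · obtain ⟨v, e, f, h, hm⟩ := exists_disc_minCells (P := P) (hcl ▸ hW) 2
    obtain ⟨v', e', f', h', hf, he⟩ := key h
    have h₀ := h'.minCells_le 2
    rw [hm]
    simp only [Matrix.cons_val] at h₀ ⊢
    nlinarith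

end TTransformation

/-! ### Stabilizations -/

section Stabilization

variable {A A' : Type*} {P : Presentation A} {P' : Presentation A'}

/-- The discs are joined at their base points, which costs one vertex. -/
theorem Disc.append {W W' : Word A} {v e f v' e' f' : ℕ} (h : Disc P W v e f)
    (h' : Disc P W' v' e' f') :
    ∃ v'', v'' + 1 = v + v' ∧ Disc P (W ++ W') v'' (e + e') (f + f') := by
  induction h with
  | nil => exact ⟨v', by omega, by simpa using h'⟩
  | @bridge x W₁ W₂ v₁ e₁ f₁ v₂ e₂ f₂ h₁ _ _ ih =>
    obtain ⟨v'', hv, hd⟩ := ih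
    refine ⟨v₁ + v'', by omega, ?_⟩
    have := h₁.bridge (x := x) hd
    rw [show e₁ + e₂ + 1 + e' = e₁ + (e₂ + e') + 1 by omega, add_assoc f₁]
    simpa using this
  | @face x U W v e f _ hl ih =>
    obtain ⟨v'', hv, hd⟩ := ih
    refine ⟨v'', hv, ?_⟩
    rw [List.append_assoc] at hd
    have := hd.face hl
    rw [add_right_comm, add_right_comm f]
    simpa using this

/-- A loop bounding a face can be inserted at any place of the boundary. -/
theorem Disc.insert_loop {b : A × Bool} (hb : P.IsFaceLabel [(b.1, !b.2)]) {W : Word A}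
    {v e f : ℕ} (h : Disc P W v e f) {W₁ W₂ : Word A} (hW : W = W₁ ++ W₂) :
    Disc P (W₁ ++ b :: W₂) v (e + 1) (f + 1) := by
  have front : ∀ {W : Word A} {v e f : ℕ}, Disc P W v e f → Disc P (b :: W) v (e + 1) (f + 1) :=
    fun h => .face (U := []) h hb
  induction h generalizing W₁ W₂ with
  | nil =>
    obtain ⟨rfl, rfl⟩ := List.nil_eq_append_iff.1 hW
    exact front .nil
  | @bridge x A B v₁ e₁ f₁ v₂ e₂ f₂ h₁ h₂ ih₁ ih₂ =>
    rcases List.cons_eq_append_iff.1 hW with ⟨rfl, rfl⟩ | ⟨T, rfl, hT⟩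
    · exact front (h₁.bridge h₂)
    · rcases List.append_eq_append_iff.1 hT with ⟨c, rfl, hc⟩ | ⟨c, rfl, rfl⟩
      · rcases List.cons_eq_append_iff.1 hc with ⟨rfl, rfl⟩ | ⟨c, rfl, hc⟩
        · have := (ih₁ (W₁ := A) (W₂ := []) (by simp)).bridge (x := x) h₂
          rw [show e₁ + e₂ + 1 + 1 = e₁ + 1 + e₂ + 1 by omega, add_right_comm f₁]
          simpa using this
        · have := h₁.bridge (x := x) (ih₂ (W₁ := c) (W₂ := W₂) (by simpa using hc))
          simpa [add_assoc] using this
      · have := (ih₁ rfl).bridge (x := x) h₂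
        rw [show e₁ + e₂ + 1 + 1 = e₁ + 1 + e₂ + 1 by omega, add_right_comm f₁]
        simpa using this
  | @face x U W v e f h hl ih =>
    rcases List.cons_eq_append_iff.1 hW with ⟨rfl, rfl⟩ | ⟨T, rfl, rfl⟩
    · exact front (h.face hl)
    · have := ih (W₁ := U ++ T) (W₂ := W₂) (by simp)
      rw [List.append_assoc] at this
      exact this.face hl

variable {i : A ↪ A'} {b : A'}

/-- The inclusion of the words over `A` into the words over `A'`. -/
def mapWord (i : A ↪ A') (W : Word A) : Word A' := W.map (Prod.map i id)

theorem invRev_mapWord (W : Word A) : invRev (mapWord i W) = mapWord i (invRev W) := by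
  simp [invRev, mapWord, Function.comp_def]

theorem Disc.mapWord (hP' : P'.rels = insert [(b, true)] (mapWord i '' P.rels)) {W : Word A}
    {v e f : ℕ} (h : Disc P W v e f) : Disc P' (mapWord i W) v e f := by
  induction h with
  | nil => exact .nil
  | @bridge x _ _ _ _ _ _ _ _ _ _ ih₁ ih₂ =>
    have := ih₁.bridge (x := Prod.map i id x) ih₂
    simpa [DehnPres.mapWord] using this
  | @face x U W _ _ _ _ hl ih =>
    rw [DehnPres.mapWord, List.map_append] at ih
    refine ih.face (x := Prod.map i id x) ?_
    obtain ⟨r, hr, hl⟩ := hl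
    refine ⟨DehnPres.mapWord i r, hr.map _, ?_⟩
    rw [invRev_mapWord, hP']
    exact hl.imp (fun k => .inr ⟨_, k, rfl⟩) fun k => .inr ⟨_, k, rfl⟩

/-- Every word over `A'` becomes a word over `A` when the letters `b` and `b⁻¹` are deleted. -/
theorem exists_filter (hi : Set.range i = {b}ᶜ) [DecidableEq A'] (W' : Word A') :
    ∃ W, mapWord i W = W'.filter (fun x => x.1 ≠ b) := by
  induction W' with
  | nil => exact ⟨[], rfl⟩
  | cons x W' ih =>
    obtain ⟨W, hW⟩ := ih
    by_cases hx : x.1 = b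
    · exact ⟨W, by simpa [hx] using hW⟩
    · obtain ⟨a, ha⟩ : x.1 ∈ Set.range i := by rw [hi]; exact hx
      refine ⟨(a, x.2) :: W, ?_⟩
      rw [List.filter_cons_of_pos (by simpa using hx), ← hW]
      simp [mapWord, ha]

theorem filter_mapWord (hi : Set.range i = {b}ᶜ) [DecidableEq A'] (W : Word A) :
    (mapWord i W).filter (fun x => x.1 ≠ b) = mapWord i W := by
  rw [List.filter_eq_self]
  intro x hx
  obtain ⟨y, -, rfl⟩ := List.mem_map.1 hx
  have : i y.1 ∈ ({b}ᶜ : Set A') := hi ▸ Set.mem_range_self y.1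
  simpa using this

/-- No face mixes `b` with other letters, so erasing `b` leaves the labels of all other faces
intact. -/
theorem isFaceLabel_cases (hP' : P'.rels = insert [(b, true)] (mapWord i '' P.rels))
    {w : Word A'} (hw : P'.IsFaceLabel w) :
    (∃ s, w = [(b, s)]) ∨ ∃ w₀, w = mapWord i w₀ ∧ P.IsFaceLabel w₀ := by
  obtain ⟨r, ⟨n, rfl⟩, hr⟩ := hw
  rw [hP'] at hr
  rcases hr with (rfl | ⟨r, hr, rfl⟩) | (hr | ⟨r', hr, hr'⟩)
  · exact .inl ⟨true, by simp⟩
  · exact .inr ⟨r.rotate n, (List.map_rotate _ _ _).symm, r, ⟨n, rfl⟩, .inl hr⟩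
  · refine .inl ⟨false, ?_⟩
    have : r = [(b, false)] := by
      rw [← FreeGroup.invRev_invRev (L₁ := r), hr]
      rfl
    rw [this, List.rotate_singleton]
  · refine .inr ⟨(invRev r').rotate n, ?_, invRev r', ⟨n, rfl⟩,
      .inr (by rwa [FreeGroup.invRev_invRev])⟩
    rw [mapWord, List.map_rotate, ← mapWord, ← invRev_mapWord, hr', FreeGroup.invRev_invRev]

/-- Faces bounded by a single edge `b` disappear with this edge, and a bridge labelled `b` is
contracted, which joins its two discs at a vertex. -/
theorem Disc.deleteLetter (hi : Set.range i = {b}ᶜ)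
    (hP' : P'.rels = insert [(b, true)] (DehnPres.mapWord i '' P.rels)) [DecidableEq A']
    {W' : Word A'} {v' e' f' : ℕ} (h : Disc P' W' v' e' f') {W : Word A}
    (hW : DehnPres.mapWord i W = W'.filter (fun x => x.1 ≠ b)) :
    ∃ v e f, Disc P W v e f ∧ v ≤ v' ∧ e ≤ e' ∧ f ≤ f' := by
  induction h generalizing W with
  | nil =>
    obtain rfl : W = [] := List.map_eq_nil_iff.1 hW
    exact ⟨_, _, _, .nil, le_rfl, le_rfl, le_rfl⟩
  | @bridge x _ _ _ _ _ _ _ _ _ _ ih₁ ih₂ =>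
    by_cases hx : x.1 = b
    · rw [List.filter_cons_of_neg (by simpa using hx), List.filter_append,
        List.filter_cons_of_neg (by simpa using hx)] at hW
      obtain ⟨W₁, W₂, rfl, h₁, h₂⟩ := List.map_eq_append_iff.1 hW
      obtain ⟨v₁, e₁, f₁, hd₁, k₁, k₂, k₃⟩ := ih₁ h₁
      obtain ⟨v₂, e₂, f₂, hd₂, l₁, l₂, l₃⟩ := ih₂ h₂
      obtain ⟨v, hv, hd⟩ := hd₁.append hd₂
      exact ⟨_, _, _, hd, by omega, by omega, by omega⟩
    · rw [List.filter_cons_of_pos (by simpa using hx), List.filter_append,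
        List.filter_cons_of_pos (by simpa using hx)] at hW
      obtain ⟨y, W, rfl, rfl, hW⟩ := List.map_eq_cons_iff.1 hW
      obtain ⟨W₁, _, rfl, h₁, hW₂⟩ := List.map_eq_append_iff.1 hW
      obtain ⟨z, W₂, rfl, hz, h₂⟩ := List.map_eq_cons_iff.1 hW₂
      obtain rfl : z = (y.1, !y.2) :=
        (i.injective.prodMap Function.injective_id) (by simpa using hz)
      obtain ⟨v₁, e₁, f₁, hd₁, k₁, k₂, k₃⟩ := ih₁ h₁
      obtain ⟨v₂, e₂, f₂, hd₂, l₁, l₂, l₃⟩ := ih₂ h₂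
      exact ⟨_, _, _, hd₁.bridge hd₂, by omega, by omega, by omega⟩
  | @face x U W'' _ _ _ _ hl ih =>
    rcases isFaceLabel_cases hP' hl with ⟨s, hs⟩ | ⟨w₀, hw₀, hl₀⟩
    · simp only [List.cons.injEq, Prod.mk.injEq] at hs
      obtain ⟨⟨hx, -⟩, rfl⟩ := hs
      rw [List.filter_cons_of_neg (by simpa using hx)] at hW
      obtain ⟨v, e, f, hd, k₁, k₂, k₃⟩ := ih hW
      exact ⟨v, e, f, hd, by omega, by omega, by omega⟩
    · obtain ⟨y, U₀, rfl, hy, hU₀⟩ := List.map_eq_cons_iff.1 hw₀.symm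
      have hU : U.filter (fun x => x.1 ≠ b) = U := by
        rw [← hU₀]; exact filter_mapWord hi U₀
      have hx : x.1 ≠ b := by
        have : i y.1 ∈ ({b}ᶜ : Set A') := hi ▸ Set.mem_range_self y.1
        rw [show x.1 = i y.1 from (congrArg Prod.fst hy).symm]
        exact this
      rw [List.filter_cons_of_pos (by simpa using hx)] at hW
      obtain ⟨z, W₀, rfl, rfl, hW₀⟩ := List.map_eq_cons_iff.1 hW
      obtain rfl : y = (z.1, !z.2) :=
        (i.injective.prodMap Function.injective_id) (by simpa using hy)
      obtain ⟨v, e, f, hd, k₁, k₂, k₃⟩ := ih (W := U₀ ++ W₀) (by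
        rw [DehnPres.mapWord, List.map_append, hU₀, hW₀, List.filter_append, hU])
      exact ⟨_, _, _, hd.face hl₀, by omega, by omega, by omega⟩

/-- The erased letters come back one by one as loops bounding faces, so the number of vertices is
unchanged; `W₁` is the prefix already restored. -/
theorem Disc.insertLetters (hP' : P'.rels = insert [(b, true)] (DehnPres.mapWord i '' P.rels))
    [DecidableEq A'] {v e f : ℕ} (W' W₁ : Word A')
    (h : Disc P' (W₁ ++ W'.filter (fun x => x.1 ≠ b)) v e f) :
    ∃ k ≤ W'.length, Disc P' (W₁ ++ W') v (e + k) (f + k) := by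
  induction W' generalizing W₁ with
  | nil => exact ⟨0, le_rfl, h⟩
  | cons x W' ih =>
    by_cases hx : x.1 = b
    · rw [List.filter_cons_of_neg (by simpa using hx)] at h
      obtain ⟨k, hk, hd⟩ := ih W₁ h
      refine ⟨k + 1, by simpa using hk, hd.insert_loop ⟨_, .refl _, ?_⟩ rfl⟩
      have hb : [(b, true)] ∈ P'.rels := hP' ▸ Set.mem_insert _ _
      rcases x with ⟨a, _ | _⟩
      · obtain rfl : a = b := hx
        exact .inl hb
      · obtain rfl : a = b := hx
        exact .inr hb
    · rw [List.filter_cons_of_pos (by simpa using hx)] at h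
      obtain ⟨k, hk, hd⟩ := ih (W₁ ++ [x]) (by simpa using h)
      exact ⟨k, by simpa using hk.trans (Nat.le_succ _), by simpa using hd⟩

theorem AddsLetter.linEquiv [Finite A] [Finite A'] (h : AddsLetter P P') (j : Fin 3) :
    LinEquiv (dehn P' j) (dehn P j) := by
  classical
  obtain ⟨i, b, hi, hP'⟩ := h
  change P'.rels = insert [(b, true)] (mapWord i '' P.rels) at hP'
  constructor
  · refine dominated_of_minCells_le 1 (fun W' hW' _ => ?_)
      ((Disc.minCells_le .nil j).trans (by fin_cases j <;> simp))
    obtain ⟨W, hW⟩ := exists_filter hi W'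
    obtain ⟨v', e', f', h'⟩ := exists_disc_of_mem_closure hW'
    -- Erasing `b` from a diagram for `W'` serves here only to show that `W` lies in the closure for
    -- `P`.
    obtain ⟨_, _, _, h₁, -⟩ := h'.deleteLetter hi hP' hW
    obtain ⟨v, e, f, hd, hm⟩ := exists_disc_minCells h₁.mem_closure j
    have hd' := hd.mapWord hP'
    rw [hW] at hd'
    obtain ⟨k, hk, hd'⟩ := Disc.insertLetters hP' W' [] hd'
    refine ⟨W, h₁.mem_closure, ?_, ?_⟩
    · have h₁ := congrArg List.length hW
      rw [mapWord, List.length_map] at h₁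
      rw [h₁]
      exact List.length_filter_le _ _
    · rw [hm, one_mul, one_mul]
      refine (hd'.minCells_le j).trans ?_
      fin_cases j <;> simp <;> omega
  · refine dominated_of_minCells_le 1 (fun W hW _ => ⟨mapWord i W, ?_, by simp [mapWord], ?_⟩)
      ((Disc.minCells_le .nil j).trans (by fin_cases j <;> simp))
    · obtain ⟨v, e, f, hd⟩ := exists_disc_of_mem_closure hW
      exact (hd.mapWord hP').mem_closure
    · obtain ⟨v₀, e₀, f₀, hd₀⟩ := exists_disc_of_mem_closure hW
      obtain ⟨v', e', f', hd, hm⟩ := exists_disc_minCells (hd₀.mapWord hP').mem_closure j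
      -- The boundary contains no `b`, so erasing `b` from the minimal diagram over `P'` leaves its
      -- boundary label unchanged.
      obtain ⟨v, e, f, hd', h₁, h₂, h₃⟩ := hd.deleteLetter hi hP' (filter_mapWord hi W).symm
      rw [hm, one_mul]
      refine ((hd'.minCells_le j).trans ?_).trans (Nat.le_add_right _ _)
      fin_cases j <;> simp <;> omega

end Stabilization

end DehnPres

theorem theorem1p6 :
    (∀ (A : Type*) [Finite A] (P P' : DehnPres.Presentation A),
      DehnPres.IsTTransformation P P' →
        DehnPres.Dominated (DehnPres.dehn P' 0) (DehnPres.dehn P 1) ∧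
        DehnPres.LinEquiv (DehnPres.dehn P' 1) (DehnPres.dehn P 1) ∧
        DehnPres.LinEquiv (DehnPres.dehn P' 2) (DehnPres.dehn P 2)) ∧
    (∀ (A A' : Type*) [Finite A] [Finite A']
      (P : DehnPres.Presentation A) (P' : DehnPres.Presentation A'),
      DehnPres.IsStabilization P P' →
        ∀ j : Fin 3, DehnPres.LinEquiv (DehnPres.dehn P' j) (DehnPres.dehn P j)) := by
  refine ⟨fun A _ P P' h => ?_, fun A A' _ _ P P' h j => ?_⟩
  · obtain ⟨S, U, -, hS, hU, hrels, hcl⟩ := h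
    have h₁ : (P.rels \ P'.rels).Finite := hS.subset fun r hr => by
      by_contra hrS
      exact hr.2 (hrels ▸ .inl ⟨hr.1, hrS⟩)
    have h₂ : (P'.rels \ P.rels).Finite := hU.subset fun r hr => by
      have hr₁ : r ∈ (P.rels \ S) ∪ U := hrels ▸ hr.1
      exact hr₁.resolve_left fun k => hr.2 k.1
    have h₃ := DehnPres.dominated_of_finite_diff h₁ hcl
    have h₄ := DehnPres.dominated_of_finite_diff h₂ hcl.symm
    exact ⟨h₃.1, ⟨h₃.2.1, h₄.2.1⟩, ⟨h₃.2.2, h₄.2.2⟩⟩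
  · rcases h with h | h
    · exact h.linEquiv j
    · exact ⟨(h.linEquiv j).2, (h.linEquiv j).1⟩
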